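/- Let $S$ be a unital inverse semigroup with unit $e$; write $s^*$ for the generalized inverse of $s$. A Busby–Smith twisted action $(A,S,\alpha,u)$ of $S$ on a $C^*$-algebra $A$ consists of closed ideals $A_s$ of $A$, isomorphisms $\alpha_s:A_{s^*}\to A_s$ $(s\in S)$ and unitary multipliers $u_{s,t}$ of $A_{st}$ $(s,t\in S)$ such that $A_e=A$; $\alpha_s\alpha_t=\mathrm{Ad}\,u_{s,t}\circ\alpha_{st}$ as partial maps (with equal domains); $u_{s,t}=1$ if $s$ or $t$ is idempotent; and $\alpha_r(au_{s,t})u_{r,st}=\alpha_r(a)u_{r,s}u_{rs,t}$ for $a\in A_{r^*}A_{st}$. A Morita equivalence $(X,\phi)$ between the twisted actions $(A,S,\alpha,u)$ and $(B,S,\beta,v)$ consists of an $A$–$B$ imprimitivity bimodule $X$ with $X_s:=A_s\cdot X=X\cdot B_s$ for all $s\in S$ and of maps $\phi_s:X_{s^*}\to X_s$ such that each $(\alpha_s,\phi_s,\beta_s)$ is an isomorphism between the imprimitivity subbimodules ${}_{A_{s^*}}(X_{s^*})_{B_{s^*}}$ and ${}_{A_s}(X_s)_{B_s}$ (that is, $\phi_s$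 is surjective and, together with $\alpha_s$ and $\beta_s$, respects both module actions and both inner products), and such that $\phi_s\phi_t=u_{s,t}\cdot\phi_{st}(\cdot)\cdot v_{s,t}^*$ as partial maps for all $s,t\in S$. The linking algebra of ${}_AX_B$ is the $C^*$-algebra $C=\begin{pmatrix}A&X\\ \tilde X&B\end{pmatrix}$, where $\tilde X$ is the reverse module of $X$, with the operations $$\begin{pmatrix}a&x\\ \tilde y&b\end{pmatrix}\begin{pmatrix}c&z\\ \tilde w&d\end{pmatrix}=\begin{pmatrix}ac+{}_A\langle x,w\rangle&a\cdot z+x\cdot d\\ \tilde y\cdot c+b\cdot\tilde w&\langle y,z\rangle_B+bd\end{pmatrix},\qquad \begin{pmatrix}a&x\\ \tilde y&b\end{pmatrix}^*=\begin{pmatrix}a^*&y\\ \tilde x&b^*\end{pmatrix}.$$ **Proposition.** Let $(X,\phi)$ be a Morita equivalence between the Busby–Smith twisted actions $(A,S,\alpha,u)$ and $(B,S,\beta,v)$. Then the formulas $$\gamma_s\begin{pmatrix}a&x\\ \tilde y&b\end{pmatrix}=\begin{pmatrix}\alpha_s(a)&\phi_s(x)\\ \phi_s(y)^{\sim}&\beta_s(b)\end{pmatrix},\qquad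 w_{s,t}=\begin{pmatrix}u_{s,t}&0\\0&v_{s,t}\end{pmatrix}$$ define a Busby–Smith twisted action $(C,S,\gamma,w)$ on the linking algebra $C$ of ${}_AX_B$, with the ideals $C_s=\begin{pmatrix}A_s&X_s\\ \tilde X_s&B_s\end{pmatrix}$, so that $\gamma_s:C_{s^*}\to C_s$; here $w_{s,t}$ is the multiplier of $C_{st}$ given by matrix multiplication. Moreover, let $Y=\begin{pmatrix}0&X\\0&B\end{pmatrix}\subset C$, on which $C$ acts by left multiplication and $B$ by $\begin{pmatrix}0&x\\0&b\end{pmatrix}\cdot d=\begin{pmatrix}0&x\cdot d\\0&bd\end{pmatrix}$, with the inner products ${}_C\langle y,z\rangle=yz^*$ and $\left\langle\begin{pmatrix}0&x\\0&b\end{pmatrix},\begin{pmatrix}0&z\\0&d\end{pmatrix}\right\rangle_B=\langle x,z\rangle_B+b^*d$. Then $Y$ is a $C$–$B$ imprimitivity bimodule, and $(Y,\gamma(\cdot)|_Y)$, that is, $Y$ with the restrictions of the maps $\gamma_s$ to $Y_{s^*}=C_{s^*}\cdot Y$, is a Morita equivalence between $(C,S,\gamma,w)$ and $(B,S,\beta,v)$.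 -/

import Mathlib

/-- An inverse monoid (unital inverse semigroup): every `s` has a unique generalized inverse,
written `s⁻¹` (this is `s^*` in the usual notation for inverse semigroups). -/
class InverseMonoid (S : Type*) extends Monoid S, Inv S where
  mul_inv_mul : ∀ s : S, s * s⁻¹ * s = s
  inv_mul_inv : ∀ s : S, s⁻¹ * s * s⁻¹ = s⁻¹
  inv_unique : ∀ s t : S, s * t * s = s → t * s * t = t → t = s⁻¹

/-- A closed two-sided ideal of a C⋆-algebra. (Such an ideal is automatically a self-adjoint linear
subspace, so that `smul_mem'` and `star_mem'` exclude nothing.) -/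
structure ClosedIdeal (A : Type*) [NonUnitalCStarAlgebra A] where
  carrier : Set A
  zero_mem' : (0 : A) ∈ carrier
  add_mem' : ∀ {a b : A}, a ∈ carrier → b ∈ carrier → a + b ∈ carrier
  smul_mem' : ∀ (c : ℂ) {a : A}, a ∈ carrier → c • a ∈ carrier
  star_mem' : ∀ {a : A}, a ∈ carrier → star a ∈ carrier
  mul_mem_left' : ∀ (a : A) {b : A}, b ∈ carrier → a * b ∈ carrier
  mul_mem_right' : ∀ {a : A} (b : A), a ∈ carrier → a * b ∈ carrier
  isClosed' : IsClosed carrier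

namespace ClosedIdeal

variable {A : Type*} [NonUnitalCStarAlgebra A]

instance : SetLike (ClosedIdeal A) A where
  coe := carrier
  coe_injective I J h := by cases I; cases J; congr

instance : NonUnitalSubringClass (ClosedIdeal A) A where
  add_mem {I} _ _ ha hb := I.add_mem' ha hb
  zero_mem I := I.zero_mem'
  neg_mem {I a} ha := by
    have h : (-1 : ℂ) • a ∈ I.carrier := I.smul_mem' (-1) ha
    rwa [neg_one_smul] at h
  mul_mem {I a} _ _ hb := I.mul_mem_left' a hb

instance : SMulMemClass (ClosedIdeal A) ℂ A where
  smul_mem {I} c _ ha := I.smul_mem' c ha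

instance : StarMemClass (ClosedIdeal A) A where
  star_mem {I} _ ha := I.star_mem' ha

instance (I : ClosedIdeal A) : IsClosed (I : Set A) := I.isClosed'

/-- The multiplier algebra `M(I)` of a closed ideal. An element `m` consists of `m.fst : a ↦ m a`
and `m.snd : a ↦ a m`. -/
abbrev Mult (I : ClosedIdeal A) : Type _ := DoubleCentralizer ℂ I

end ClosedIdeal

/-- A Busby–Smith twisted action of the inverse monoid `S` on the C⋆-algebra `A`. -/
structure TwistedAction (S A : Type*) [InverseMonoid S] [NonUnitalCStarAlgebra A] where
  /-- The closed ideals `A_s`. -/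
  ideal : S → ClosedIdeal A
  /-- The isomorphisms `β_s : A_{s^*} → A_s`. -/
  map : ∀ s : S, ideal s⁻¹ ≃⋆ₐ[ℂ] ideal s
  /-- The unitary multipliers `v_{s,t}` of `A_{st}`. -/
  mult : ∀ s t : S, unitary (ideal (s * t)).Mult
  ideal_one : ∀ a : A, a ∈ ideal 1
  /-- `β_s β_t` and `Ad v_{s,t} ∘ β_{st}` have the same domain. -/
  dom_comp : ∀ (s t : S) (a : A), a ∈ ideal (s * t)⁻¹ ↔
    ∃ h : a ∈ ideal t⁻¹, (map t ⟨a, h⟩ : A) ∈ ideal s⁻¹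
  /-- `β_s β_t = Ad v_{s,t} ∘ β_{st}`. -/
  map_comp : ∀ (s t : S) (a : A) (h : a ∈ ideal (s * t)⁻¹) (h₁ : a ∈ ideal t⁻¹)
    (h₂ : (map t ⟨a, h₁⟩ : A) ∈ ideal s⁻¹),
    (map s ⟨map t ⟨a, h₁⟩, h₂⟩ : A) =
      ((mult s t : (ideal (s * t)).Mult).fst
        ((star (mult s t : (ideal (s * t)).Mult)).snd (map (s * t) ⟨a, h⟩)) : ideal (s * t))
  mult_idem : ∀ s t : S, IsIdempotentElem s ∨ IsIdempotentElem t → mult s t = 1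
  /-- The cocycle identity `β_r(a v_{s,t}) v_{r,st} = β_r(a) v_{r,s} v_{rs,t}` for
  `a ∈ A_{r^*} A_{st} = A_{r^*} ∩ A_{st}`; the memberships say that both sides make sense. -/
  cocycle : ∀ (r s t : S) (a : A) (h₁ : a ∈ ideal r⁻¹) (h₂ : a ∈ ideal (s * t)),
    ∃ (p₁ : ((mult s t : (ideal (s * t)).Mult).snd ⟨a, h₂⟩ : A) ∈ ideal r⁻¹)
      (p₂ : (map r ⟨(mult s t : (ideal (s * t)).Mult).snd ⟨a, h₂⟩, p₁⟩ : A) ∈ ideal (r * (s * t)))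
      (p₃ : (map r ⟨a, h₁⟩ : A) ∈ ideal (r * s))
      (p₄ : ((mult r s : (ideal (r * s)).Mult).snd ⟨map r ⟨a, h₁⟩, p₃⟩ : A) ∈ ideal (r * s * t)),
      ((mult r (s * t) : (ideal (r * (s * t))).Mult).snd
          ⟨map r ⟨(mult s t : (ideal (s * t)).Mult).snd ⟨a, h₂⟩, p₁⟩, p₂⟩ : A) =
        ((mult (r * s) t : (ideal (r * s * t)).Mult).snd
          ⟨(mult r s : (ideal (r * s)).Mult).snd ⟨map r ⟨a, h₁⟩, p₃⟩, p₄⟩ : A)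

/-- The data of a left module action of `A` on `X` and an `A`-valued inner product. -/
class LeftInnerData (A X : Type*) where
  act : A → X → X
  inner : X → X → A

/-- The data of a right module action of `B` on `X` and a `B`-valued inner product. -/
class RightInnerData (B X : Type*) where
  act : X → B → X
  inner : X → X → B

infixr:73 " ⊳ " => LeftInnerData.act
infixl:74 " ⊲ " => RightInnerData.act

/-- The left inner product, with values in `A`. -/
abbrev linner (A : Type*) {X : Type*} [LeftInnerData A X] (x y : X) : A := LeftInnerData.inner x y

/-- The right inner product, with values in `B`. -/
abbrev rinner (B : Type*) {X : Type*} [RightInnerData B X] (x y : X) : B := RightInnerData.inner x y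

/-- `X` is an `A`–`B` imprimitivity bimodule: a full left Hilbert `A`-module and a full right
Hilbert `B`-module, with commuting actions and compatible inner products. Positivity in a
C⋆-algebra is expressed as being of the form `a^* a`. The norm of `X` is the one given by either
inner product (the two norms of an imprimitivity bimodule always coincide). -/
class IsImprimitivityBimodule (A B X : Type*) [NonUnitalCStarAlgebra A] [NonUnitalCStarAlgebra B]
    [NormedAddCommGroup X] [NormedSpace ℂ X] [LeftInnerData A X] [RightInnerData B X] : Prop where
  complete : CompleteSpace X
  -- the left module structure
  lact_add : ∀ (a : A) (x y : X), a ⊳ (x + y) = a ⊳ x + a ⊳ y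
  add_lact : ∀ (a b : A) (x : X), (a + b) ⊳ x = a ⊳ x + b ⊳ x
  lact_smul : ∀ (c : ℂ) (a : A) (x : X), a ⊳ (c • x) = c • a ⊳ x
  smul_lact : ∀ (c : ℂ) (a : A) (x : X), (c • a) ⊳ x = c • a ⊳ x
  mul_lact : ∀ (a b : A) (x : X), (a * b) ⊳ x = a ⊳ b ⊳ x
  -- the right module structure
  ract_add : ∀ (x : X) (a b : B), x ⊲ (a + b) = x ⊲ a + x ⊲ b
  add_ract : ∀ (x y : X) (b : B), (x + y) ⊲ b = x ⊲ b + y ⊲ b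
  ract_smul : ∀ (c : ℂ) (x : X) (b : B), x ⊲ (c • b) = c • (x ⊲ b)
  smul_ract : ∀ (c : ℂ) (x : X) (b : B), (c • x) ⊲ b = c • (x ⊲ b)
  ract_mul : ∀ (x : X) (a b : B), x ⊲ (a * b) = x ⊲ a ⊲ b
  lact_ract : ∀ (a : A) (x : X) (b : B), a ⊳ (x ⊲ b) = (a ⊳ x) ⊲ b
  -- the left inner product
  add_linner : ∀ x y z : X, linner A (x + y) z = linner A x z + linner A y z
  smul_linner : ∀ (c : ℂ) (x y : X), linner A (c • x) y = c • linner A x y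
  lact_linner : ∀ (a : A) (x y : X), linner A (a ⊳ x) y = a * linner A x y
  star_linner : ∀ x y : X, star (linner A x y) = linner A y x
  linner_self_nonneg : ∀ x : X, ∃ a : A, linner A x x = star a * a
  linner_self_eq_zero : ∀ x : X, linner A x x = 0 → x = 0
  norm_sq_linner : ∀ x : X, ‖x‖ ^ 2 = ‖linner A x x‖
  left_full : closure (Submodule.span ℂ {a : A | ∃ x y : X, a = linner A x y} : Set A) = Set.univ
  -- the right inner product
  rinner_add : ∀ x y z : X, rinner B x (y + z) = rinner B x y + rinner B x z
  rinner_smul : ∀ (c : ℂ) (x y : X), rinner B x (c • y) = c • rinner B x y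
  rinner_ract : ∀ (x y : X) (b : B), rinner B x (y ⊲ b) = rinner B x y * b
  star_rinner : ∀ x y : X, star (rinner B x y) = rinner B y x
  rinner_self_nonneg : ∀ x : X, ∃ b : B, rinner B x x = star b * b
  rinner_self_eq_zero : ∀ x : X, rinner B x x = 0 → x = 0
  norm_sq_rinner : ∀ x : X, ‖x‖ ^ 2 = ‖rinner B x x‖
  right_full : closure (Submodule.span ℂ {b : B | ∃ x y : X, b = rinner B x y} : Set B) = Set.univ
  -- compatibility
  linner_lact : ∀ x y z : X, linner A x y ⊳ z = x ⊲ rinner B y z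

namespace IsImprimitivityBimodule

variable {A B X : Type*} [NonUnitalCStarAlgebra A] [NonUnitalCStarAlgebra B]
  [NormedAddCommGroup X] [NormedSpace ℂ X] [LeftInnerData A X] [RightInnerData B X]

lemma linner_add (h : IsImprimitivityBimodule A B X)
    (x y z : X) : linner A x (y + z) = linner A x y + linner A x z := by
  rw [← h.star_linner, h.add_linner, star_add, h.star_linner,
    h.star_linner]

lemma linner_smul (h : IsImprimitivityBimodule A B X)
    (c : ℂ) (x y : X) : linner A x (c • y) = star c • linner A x y := by
  rw [← h.star_linner, h.smul_linner, star_smul, h.star_linner]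

lemma linner_lact_right (h : IsImprimitivityBimodule A B X)
    (a : A) (x y : X) : linner A x (a ⊳ y) = linner A x y * star a := by
  rw [← h.star_linner, h.lact_linner, star_mul, h.star_linner]

lemma add_rinner (h : IsImprimitivityBimodule A B X)
    (x y z : X) : rinner B (x + y) z = rinner B x z + rinner B y z := by
  rw [← h.star_rinner, h.rinner_add, star_add, h.star_rinner,
    h.star_rinner]

lemma smul_rinner (h : IsImprimitivityBimodule A B X)
    (c : ℂ) (x y : X) : rinner B (c • x) y = star c • rinner B x y := by
  rw [← h.star_rinner, h.rinner_smul, star_smul, h.star_rinner]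

lemma ract_rinner (h : IsImprimitivityBimodule A B X)
    (x y : X) (b : B) : rinner B (x ⊲ b) y = star b * rinner B x y := by
  rw [← h.star_rinner, h.rinner_ract, star_mul, h.star_rinner]

lemma lact_zero (h : IsImprimitivityBimodule A B X) (a : A) : a ⊳ (0 : X) = 0 := by
  simpa using h.lact_smul (0 : ℂ) a (0 : X)
lemma zero_lact (h : IsImprimitivityBimodule A B X) (x : X) : (0 : A) ⊳ x = 0 := by
  simpa using h.smul_lact (0 : ℂ) (0 : A) x
lemma ract_zero (h : IsImprimitivityBimodule A B X) (x : X) : x ⊲ (0 : B) = 0 := by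
  simpa using h.ract_smul (0 : ℂ) x (0 : B)
lemma zero_ract (h : IsImprimitivityBimodule A B X) (b : B) : (0 : X) ⊲ b = 0 := by
  simpa using h.smul_ract (0 : ℂ) (0 : X) b
lemma linner_zero (h : IsImprimitivityBimodule A B X) (x : X) : linner A x 0 = 0 := by
  simpa using h.linner_smul (0 : ℂ) x (0 : X)
lemma zero_linner (h : IsImprimitivityBimodule A B X) (x : X) : linner A 0 x = 0 := by
  simpa using h.smul_linner (0 : ℂ) (0 : X) x
lemma rinner_zero (h : IsImprimitivityBimodule A B X) (x : X) : rinner B x 0 = 0 := by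
  simpa using h.rinner_smul (0 : ℂ) x (0 : X)
lemma zero_rinner (h : IsImprimitivityBimodule A B X) (x : X) : rinner B 0 x = 0 := by
  simpa using h.smul_rinner (0 : ℂ) (0 : X) x

lemma eq_zero_of_ract (h : IsImprimitivityBimodule A B X)
    {b : B} (h' : ∀ x : X, x ⊲ b = 0) : b = 0 := by
  have h1 : ∀ d ∈ closure
      (Submodule.span ℂ {b : B | ∃ x y : X, b = rinner B x y} : Set B), d * b = 0 := by
    intro d hd
    refine closure_minimal (t := {d : B | d * b = 0}) ?_
      (isClosed_eq (by fun_prop) continuous_const) hd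
    intro d hd
    induction hd using Submodule.span_induction with
    | mem d hd =>
      obtain ⟨x, y, rfl⟩ := hd
      rw [Set.mem_ofPred_eq, ← h.rinner_ract, h', h.rinner_zero]
    | zero => simp
    | add x y _ _ hx hy =>
      rw [Set.mem_ofPred_eq] at *
      rw [add_mul, hx, hy, add_zero]
    | smul c x _ hx =>
      rw [Set.mem_ofPred_eq] at *
      rw [smul_mul_assoc, hx, smul_zero]
  have h2 := h1 (star b) (by rw [h.right_full]; trivial)
  exact CStarRing.star_mul_self_eq_zero_iff b |>.1 h2

lemma eq_zero_of_lact (h : IsImprimitivityBimodule A B X)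
    {a : A} (h' : ∀ x : X, a ⊳ x = 0) : a = 0 := by
  have h1 : ∀ d ∈ closure
      (Submodule.span ℂ {a : A | ∃ x y : X, a = linner A x y} : Set A), a * d = 0 := by
    intro d hd
    refine closure_minimal (t := {d : A | a * d = 0}) ?_
      (isClosed_eq (by fun_prop) continuous_const) hd
    intro d hd
    induction hd using Submodule.span_induction with
    | mem d hd =>
      obtain ⟨x, y, rfl⟩ := hd
      rw [Set.mem_ofPred_eq, ← h.lact_linner, h', h.zero_linner]
    | zero => simp
    | add x y _ _ hx hy =>
      rw [Set.mem_ofPred_eq] at *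
      rw [mul_add, hx, hy, add_zero]
    | smul c x _ hx =>
      rw [Set.mem_ofPred_eq] at *
      rw [mul_smul_comm, hx, smul_zero]
  have h2 := h1 (star a) (by rw [h.left_full]; trivial)
  exact CStarRing.mul_star_self_eq_zero_iff a |>.1 h2

lemma lact_neg (h : IsImprimitivityBimodule A B X) (a : A) (x : X) : a ⊳ (-x) = -(a ⊳ x) := by
  simpa using h.lact_smul (-1 : ℂ) a x
lemma neg_lact (h : IsImprimitivityBimodule A B X) (a : A) (x : X) : (-a) ⊳ x = -(a ⊳ x) := by
  simpa using h.smul_lact (-1 : ℂ) a x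
lemma ract_neg (h : IsImprimitivityBimodule A B X) (x : X) (b : B) : x ⊲ (-b) = -(x ⊲ b) := by
  simpa using h.ract_smul (-1 : ℂ) x b

/-- The left action is by adjointable operators. -/
lemma rinner_lact_left (h : IsImprimitivityBimodule A B X)
    (a : A) (x y : X) : rinner B (a ⊳ x) y = rinner B x (star a ⊳ y) := by
  rw [← sub_eq_zero]
  refine h.eq_zero_of_ract fun z => ?_
  rw [sub_eq_add_neg, h.ract_add, h.ract_neg, ← h.linner_lact,
    ← h.linner_lact, h.linner_lact_right, h.mul_lact, add_neg_cancel]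

/-- The right action is by adjointable operators. -/
lemma linner_ract_left (h : IsImprimitivityBimodule A B X)
    (x y : X) (b : B) : linner A (x ⊲ b) y = linner A x (y ⊲ star b) := by
  rw [← sub_eq_zero]
  refine h.eq_zero_of_lact fun z => ?_
  rw [sub_eq_add_neg, h.add_lact, h.neg_lact, h.linner_lact,
    h.linner_lact, h.ract_rinner, star_star, h.ract_mul, add_neg_cancel]

lemma norm_lact_le (h : IsImprimitivityBimodule A B X) (a : A) (x : X) : ‖a ⊳ x‖ ≤ ‖a‖ * ‖x‖ := by
  refine le_of_sq_le_sq ?_ (by positivity)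
  rw [h.norm_sq_linner, h.lact_linner, h.linner_lact_right, mul_pow,
    h.norm_sq_linner, sq]
  calc _ ≤ ‖a‖ * (‖linner A x x‖ * ‖star a‖) :=
        (norm_mul_le _ _).trans (by gcongr; exact norm_mul_le _ _)
    _ = _ := by rw [norm_star]; ring

lemma norm_ract_le (h : IsImprimitivityBimodule A B X) (x : X) (b : B) : ‖x ⊲ b‖ ≤ ‖x‖ * ‖b‖ := by
  refine le_of_sq_le_sq ?_ (by positivity)
  rw [h.norm_sq_rinner, h.rinner_ract, h.ract_rinner, mul_pow,
    h.norm_sq_rinner, sq ‖b‖]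
  calc _ ≤ ‖star b‖ * ‖rinner B x x‖ * ‖b‖ :=
        (norm_mul_le _ _).trans (by gcongr; exact norm_mul_le _ _)
    _ = _ := by rw [norm_star]; ring

end IsImprimitivityBimodule

/-- The underlying space of the linking algebra of the imprimitivity bimodule `X`. The element
`⟨a, x, y, b⟩` is the matrix with rows `a, x` and `ỹ, b`, where `ỹ` is the element of the reverse
module `X̃` given by `y`. Recall that `c • ỹ = (c̄ • y)~`, `ỹ · a = (a^* · y)~` and
`b · ỹ = (y · b^*)~`. -/
@[ext]
structure Linking (A B X : Type*) where
  a : A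
  x : X
  y : X
  b : B

namespace Linking

set_option linter.unusedSectionVars false

variable {A B X : Type*} [NonUnitalCStarAlgebra A] [NonUnitalCStarAlgebra B]
  [NormedAddCommGroup X] [NormedSpace ℂ X]

instance : Zero (Linking A B X) := ⟨⟨0, 0, 0, 0⟩⟩
instance : Add (Linking A B X) := ⟨fun m n => ⟨m.a + n.a, m.x + n.x, m.y + n.y, m.b + n.b⟩⟩
instance : Neg (Linking A B X) := ⟨fun m => ⟨-m.a, -m.x, -m.y, -m.b⟩⟩
instance : Sub (Linking A B X) := ⟨fun m n => ⟨m.a - n.a, m.x - n.x, m.y - n.y, m.b - n.b⟩⟩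
instance : SMul ℕ (Linking A B X) := ⟨fun c m => ⟨c • m.a, c • m.x, c • m.y, c • m.b⟩⟩
instance : SMul ℤ (Linking A B X) := ⟨fun c m => ⟨c • m.a, c • m.x, c • m.y, c • m.b⟩⟩
instance : SMul ℂ (Linking A B X) := ⟨fun c m => ⟨c • m.a, c • m.x, star c • m.y, c • m.b⟩⟩
instance : Star (Linking A B X) := ⟨fun m => ⟨star m.a, m.y, m.x, star m.b⟩⟩
/-- Matrix multiplication. -/
instance [LeftInnerData A X] [RightInnerData B X] : Mul (Linking A B X) :=
  ⟨fun m n => ⟨m.a * n.a + linner A m.x n.y, m.a ⊳ n.x + m.x ⊲ n.b,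
    star n.a ⊳ m.y + n.y ⊲ star m.b, rinner B m.y n.x + m.b * n.b⟩⟩

section simps
variable (m n : Linking A B X) (c : ℂ)
@[simp] lemma zero_a : (0 : Linking A B X).a = 0 := rfl
@[simp] lemma zero_x : (0 : Linking A B X).x = 0 := rfl
@[simp] lemma zero_y : (0 : Linking A B X).y = 0 := rfl
@[simp] lemma zero_b : (0 : Linking A B X).b = 0 := rfl
@[simp] lemma add_a : (m + n).a = m.a + n.a := rfl
@[simp] lemma add_x : (m + n).x = m.x + n.x := rfl
@[simp] lemma add_y : (m + n).y = m.y + n.y := rfl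
@[simp] lemma add_b : (m + n).b = m.b + n.b := rfl
@[simp] lemma sub_a : (m - n).a = m.a - n.a := rfl
@[simp] lemma sub_x : (m - n).x = m.x - n.x := rfl
@[simp] lemma sub_y : (m - n).y = m.y - n.y := rfl
@[simp] lemma sub_b : (m - n).b = m.b - n.b := rfl
@[simp] lemma smul_a : (c • m).a = c • m.a := rfl
@[simp] lemma smul_x : (c • m).x = c • m.x := rfl
@[simp] lemma smul_y : (c • m).y = star c • m.y := rfl
@[simp] lemma smul_b : (c • m).b = c • m.b := rfl
@[simp] lemma star_a : (star m).a = star m.a := rfl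
@[simp] lemma star_x : (star m).x = m.y := rfl
@[simp] lemma star_y : (star m).y = m.x := rfl
@[simp] lemma star_b : (star m).b = star m.b := rfl
variable [LeftInnerData A X] [RightInnerData B X]
@[simp] lemma mul_a : (m * n).a = m.a * n.a + linner A m.x n.y := rfl
@[simp] lemma mul_x : (m * n).x = m.a ⊳ n.x + m.x ⊲ n.b := rfl
@[simp] lemma mul_y : (m * n).y = star n.a ⊳ m.y + n.y ⊲ star m.b := rfl
@[simp] lemma mul_b : (m * n).b = rinner B m.y n.x + m.b * n.b := rfl
end simps

instance : AddCommGroup (Linking A B X) :=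
  Function.Injective.addCommGroup (fun m : Linking A B X => (m.a, m.x, m.y, m.b))
    (fun m n h => by simpa [Linking.ext_iff] using h) rfl (fun _ _ => rfl) (fun _ => rfl)
    (fun _ _ => rfl) (fun _ _ => rfl) (fun _ _ => rfl)

instance : Module ℂ (Linking A B X) where
  one_smul m := by ext <;> simp
  mul_smul c d m := by ext <;> simp [mul_smul]
  smul_zero c := by ext <;> simp
  smul_add c m n := by ext <;> simp
  add_smul c d m := by ext <;> simp [add_smul]
  zero_smul m := by ext <;> simp

variable [LeftInnerData A X] [RightInnerData B X] [h : IsImprimitivityBimodule A B X]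

instance : NonUnitalRing (Linking A B X) where
  left_distrib m n k := by
    ext <;> simp [mul_add, h.linner_add, h.lact_add, h.ract_add, h.add_lact, h.add_ract,
      h.rinner_add] <;> abel
  right_distrib m n k := by
    ext <;> simp [add_mul, h.add_linner, h.lact_add, h.ract_add, h.add_lact, h.add_ract,
      h.add_rinner] <;> abel
  zero_mul m := by ext <;> simp [h.zero_linner, h.zero_lact, h.zero_ract, h.zero_rinner,
    h.lact_zero, h.ract_zero]
  mul_zero m := by ext <;> simp [h.linner_zero, h.zero_lact, h.zero_ract, h.rinner_zero,
    h.lact_zero, h.ract_zero]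
  mul_assoc m n k := by
    ext
    · simp [add_mul, mul_add, h.add_linner, h.linner_add, h.lact_linner, h.linner_lact_right,
        h.linner_ract_left, mul_assoc]
      abel
    · simp [h.add_lact, h.add_ract, h.lact_add, h.ract_add, h.linner_lact, h.mul_lact,
        h.lact_ract, h.ract_mul]
      abel
    · simp [h.add_lact, h.add_ract, h.lact_add, h.ract_add, h.linner_lact, h.mul_lact,
        h.lact_ract, h.ract_mul, h.star_linner, h.star_rinner]
      abel
    · simp [add_mul, mul_add, h.add_rinner, h.rinner_add, h.rinner_lact_left, h.rinner_ract,
        h.ract_rinner, mul_assoc]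
      abel

instance : StarRing (Linking A B X) where
  star_involutive m := by ext <;> simp
  star_mul m n := by ext <;> simp [h.star_linner, h.star_rinner, add_comm]
  star_add m n := by ext <;> simp

instance : StarModule ℂ (Linking A B X) where
  star_smul c m := by ext <;> simp

instance : IsScalarTower ℂ (Linking A B X) (Linking A B X) where
  smul_assoc c m n := by
    ext <;> simp [h.smul_linner, h.smul_lact, h.smul_ract, h.lact_smul, h.ract_smul,
      h.smul_rinner, smul_mul_assoc]

instance : SMulCommClass ℂ (Linking A B X) (Linking A B X) where
  smul_comm c m n := by
    ext <;> simp [h.linner_smul, h.smul_lact, h.smul_ract, h.lact_smul, h.ract_smul,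
      h.rinner_smul, mul_smul_comm]

end Linking

/-- The Hilbert `B`-module of columns `(x, b)`, on which the linking algebra acts. -/
structure LinkingColumn (A B X : Type*) where
  x : X
  b : B

namespace LinkingColumn

set_option linter.unusedSectionVars false

variable {A B X : Type*} [NonUnitalCStarAlgebra A] [NonUnitalCStarAlgebra B]
  [NormedAddCommGroup X] [NormedSpace ℂ X] [LeftInnerData A X] [RightInnerData B X]
  [h : IsImprimitivityBimodule A B X]

attribute [local instance] CStarAlgebra.spectralOrder CStarAlgebra.spectralOrderedRing

@[ext] lemma ext' {m n : LinkingColumn A B X} (h₁ : m.x = n.x) (h₂ : m.b = n.b) : m = n := by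
  cases m; cases n; congr

instance : Zero (LinkingColumn A B X) := ⟨⟨0, 0⟩⟩
instance : Add (LinkingColumn A B X) := ⟨fun m n => ⟨m.x + n.x, m.b + n.b⟩⟩
instance : Neg (LinkingColumn A B X) := ⟨fun m => ⟨-m.x, -m.b⟩⟩
instance : Sub (LinkingColumn A B X) := ⟨fun m n => ⟨m.x - n.x, m.b - n.b⟩⟩
instance : SMul ℕ (LinkingColumn A B X) := ⟨fun c m => ⟨c • m.x, c • m.b⟩⟩
instance : SMul ℤ (LinkingColumn A B X) := ⟨fun c m => ⟨c • m.x, c • m.b⟩⟩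
instance : SMul ℂ (LinkingColumn A B X) := ⟨fun c m => ⟨c • m.x, c • m.b⟩⟩
instance : SMul Bᵐᵒᵖ (LinkingColumn A B X) := ⟨fun c m => ⟨m.x ⊲ c.unop, m.b * c.unop⟩⟩

@[simp] lemma add_x (m n : LinkingColumn A B X) : (m + n).x = m.x + n.x := rfl
@[simp] lemma add_b (m n : LinkingColumn A B X) : (m + n).b = m.b + n.b := rfl
@[simp] lemma zero_x : (0 : LinkingColumn A B X).x = 0 := rfl
@[simp] lemma zero_b : (0 : LinkingColumn A B X).b = 0 := rfl
@[simp] lemma smul_x (c : ℂ) (m : LinkingColumn A B X) : (c • m).x = c • m.x := rfl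
@[simp] lemma smul_b (c : ℂ) (m : LinkingColumn A B X) : (c • m).b = c • m.b := rfl
@[simp] lemma op_smul_x (c : Bᵐᵒᵖ) (m : LinkingColumn A B X) : (c • m).x = m.x ⊲ c.unop := rfl
@[simp] lemma op_smul_b (c : Bᵐᵒᵖ) (m : LinkingColumn A B X) : (c • m).b = m.b * c.unop := rfl

instance : AddCommGroup (LinkingColumn A B X) :=
  Function.Injective.addCommGroup (fun m : LinkingColumn A B X => (m.x, m.b))
    (fun _ _ h => ext' (congrArg Prod.fst h) (congrArg Prod.snd h)) rfl (fun _ _ => rfl)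
    (fun _ => rfl) (fun _ _ => rfl) (fun _ _ => rfl) (fun _ _ => rfl)

instance : Module ℂ (LinkingColumn A B X) where
  one_smul m := by ext <;> simp
  mul_smul c d m := by ext <;> simp [mul_smul]
  smul_zero c := by ext <;> simp
  smul_add c m n := by ext <;> simp
  add_smul c d m := by ext <;> simp [add_smul]
  zero_smul m := by ext <;> simp

/-- The `B`-valued inner product `⟨x, z⟩_B + b^* d` of the columns `(x, b)` and `(z, d)`. -/
def inn (m n : LinkingColumn A B X) : B := rinner B m.x n.x + star m.b * n.b

noncomputable instance : Norm (LinkingColumn A B X) := ⟨fun m => √‖inn m m‖⟩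

lemma op_rinner_nonneg (h : IsImprimitivityBimodule A B X)
    (x : X) : 0 ≤ MulOpposite.op (rinner B x x) := by
  obtain ⟨b, hb⟩ := h.rinner_self_nonneg x
  rw [hb, MulOpposite.op_mul, MulOpposite.op_star]
  exact mul_star_self_nonneg _

lemma op_star_mul_nonneg (b : B) : 0 ≤ MulOpposite.op (star b * b) := by
  rw [MulOpposite.op_mul, MulOpposite.op_star]
  exact mul_star_self_nonneg _

noncomputable instance : CStarModule Bᵐᵒᵖ (LinkingColumn A B X) where
  inner m n := MulOpposite.op (inn m n)
  inner_add_right {_ _ _} := by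
    rw [← MulOpposite.op_add]; congr 1; simp [inn, h.rinner_add, mul_add]; abel
  inner_self_nonneg {m} := by
    rw [inn, MulOpposite.op_add]
    exact add_nonneg (op_rinner_nonneg h _) (op_star_mul_nonneg _)
  inner_self {m} := by
    constructor
    · intro hm
      rw [inn, MulOpposite.op_add] at hm
      have h1 := op_rinner_nonneg h m.x
      have h2 := op_star_mul_nonneg m.b
      ext
      · refine h.rinner_self_eq_zero _ (MulOpposite.op_injective (le_antisymm ?_ h1))
        exact (le_add_of_nonneg_right h2).trans hm.le
      · refine (CStarRing.star_mul_self_eq_zero_iff _).1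
          (MulOpposite.op_injective (le_antisymm ?_ h2))
        exact (le_add_of_nonneg_left h1).trans hm.le
    · rintro rfl; simp [inn, h.rinner_zero]
  inner_op_smul_right {c m n} := by
    apply MulOpposite.unop_injective
    simp [inn, h.rinner_ract, add_mul, mul_assoc]
  inner_smul_right_complex {_ _ _} := by
    rw [← MulOpposite.op_smul]; congr 1; simp [inn, h.rinner_smul, mul_smul_comm]
  star_inner m n := by
    rw [← MulOpposite.op_star]; congr 1; simp [inn, h.star_rinner]
  norm_eq_sqrt_norm_inner_self m := rfl

noncomputable instance : NormedAddCommGroup (LinkingColumn A B X) :=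
  NormedAddCommGroup.ofCore (CStarModule.normedSpaceCore Bᵐᵒᵖ)

noncomputable instance : NormedSpace ℂ (LinkingColumn A B X) :=
  .ofCore (CStarModule.normedSpaceCore Bᵐᵒᵖ)

lemma norm_sq (m : LinkingColumn A B X) : ‖m‖ ^ 2 = ‖inn m m‖ :=
  CStarModule.norm_sq_eq Bᵐᵒᵖ

lemma norm_inn_le (m n : LinkingColumn A B X) : ‖inn m n‖ ≤ ‖m‖ * ‖n‖ :=
  CStarModule.norm_inner_le (A := Bᵐᵒᵖ) (LinkingColumn A B X)

lemma norm_x_le (m : LinkingColumn A B X) : ‖m.x‖ ≤ ‖m‖ := by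
  refine le_of_sq_le_sq ?_ (norm_nonneg _)
  rw [norm_sq, h.norm_sq_rinner]
  exact CStarAlgebra.norm_le_norm_of_nonneg_of_le (A := Bᵐᵒᵖ) (op_rinner_nonneg h m.x)
    (le_add_of_nonneg_right (op_star_mul_nonneg m.b))

lemma norm_b_le (m : LinkingColumn A B X) : ‖m.b‖ ≤ ‖m‖ := by
  refine le_of_sq_le_sq ?_ (norm_nonneg _)
  rw [norm_sq, sq, ← CStarRing.norm_star_mul_self]
  exact CStarAlgebra.norm_le_norm_of_nonneg_of_le (A := Bᵐᵒᵖ) (op_star_mul_nonneg m.b)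
    (le_add_of_nonneg_left (op_rinner_nonneg h m.x))

lemma norm_le (m : LinkingColumn A B X) : ‖m‖ ≤ ‖m.x‖ + ‖m.b‖ := by
  refine le_of_sq_le_sq ?_ (by positivity)
  rw [norm_sq]
  calc _ ≤ ‖rinner B m.x m.x‖ + ‖star m.b * m.b‖ := norm_add_le _ _
    _ = ‖m.x‖ ^ 2 + ‖m.b‖ ^ 2 := by
      rw [← h.norm_sq_rinner, CStarRing.norm_star_mul_self, sq ‖m.b‖]
    _ ≤ _ := by nlinarith [norm_nonneg m.x, norm_nonneg m.b]

end LinkingColumn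

namespace Linking

set_option linter.unusedSectionVars false

variable {A B X : Type*} [NonUnitalCStarAlgebra A] [NonUnitalCStarAlgebra B]
  [NormedAddCommGroup X] [NormedSpace ℂ X] [LeftInnerData A X] [RightInnerData B X]
  [h : IsImprimitivityBimodule A B X]

/-- Matrix multiplication on columns. -/
def actCol (m : Linking A B X) : LinkingColumn A B X →ₗ[ℂ] LinkingColumn A B X where
  toFun ξ := ⟨m.a ⊳ ξ.x + m.x ⊲ ξ.b, rinner B m.y ξ.x + m.b * ξ.b⟩
  map_add' ξ η := by
    ext <;> simp [h.lact_add, h.ract_add, h.rinner_add, mul_add] <;> abel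
  map_smul' c ξ := by
    ext <;> simp [h.lact_smul, h.ract_smul, h.rinner_smul, mul_smul_comm]

@[simp] lemma actCol_x (m : Linking A B X) (ξ : LinkingColumn A B X) :
    (actCol m ξ).x = m.a ⊳ ξ.x + m.x ⊲ ξ.b := rfl
@[simp] lemma actCol_b (m : Linking A B X) (ξ : LinkingColumn A B X) :
    (actCol m ξ).b = rinner B m.y ξ.x + m.b * ξ.b := rfl

lemma actCol_mul (m n : Linking A B X) (ξ : LinkingColumn A B X) :
    actCol (m * n) ξ = actCol m (actCol n ξ) := by
  ext
  · simp [h.add_lact, h.add_ract, h.lact_add, h.ract_add, h.linner_lact, h.mul_lact,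
        h.lact_ract, h.ract_mul]
    abel
  · simp [add_mul, mul_add, h.add_rinner, h.rinner_add, h.rinner_lact_left, h.rinner_ract,
        h.ract_rinner, mul_assoc]
    abel

lemma actCol_add (m n : Linking A B X) (ξ : LinkingColumn A B X) :
    actCol (m + n) ξ = actCol m ξ + actCol n ξ := by
  ext <;> simp [h.add_lact, h.add_ract, h.add_rinner, add_mul] <;> abel

lemma inn_actCol (m : Linking A B X) (ξ η : LinkingColumn A B X) :
    LinkingColumn.inn (actCol m ξ) η = LinkingColumn.inn ξ (actCol (star m) η) := by
  simp [LinkingColumn.inn, h.add_rinner, h.rinner_add, h.rinner_lact_left, h.ract_rinner,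
    h.rinner_ract, add_mul, mul_add, mul_assoc, h.star_rinner]
  abel

lemma norm_rinner_le (h : IsImprimitivityBimodule A B X) (x y : X) :
    ‖rinner B x y‖ ≤ ‖x‖ * ‖y‖ := by
  have h0 := LinkingColumn.norm_inn_le (⟨x, 0⟩ : LinkingColumn A B X) ⟨y, 0⟩
  have h1 := LinkingColumn.norm_le (⟨x, 0⟩ : LinkingColumn A B X)
  have h2 := LinkingColumn.norm_le (⟨y, 0⟩ : LinkingColumn A B X)
  have h3 := norm_nonneg (⟨y, 0⟩ : LinkingColumn A B X)
  simp only [LinkingColumn.inn, star_zero, mul_zero, add_zero, norm_zero] at h0 h1 h2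
  exact h0.trans (by gcongr)

lemma norm_linner_le (h : IsImprimitivityBimodule A B X) (x y : X) :
    ‖linner A x y‖ ≤ ‖x‖ * ‖y‖ := by
  refine le_of_sq_le_sq ?_ (by positivity)
  have h1 : ‖linner A x y * star (linner A x y)‖ ≤ ‖x‖ ^ 2 * ‖y‖ ^ 2 := by
    obtain ⟨e, he⟩ := h.rinner_self_nonneg y
    have h2 : linner A (x ⊲ star e ⊲ e) x = linner A (x ⊲ star e) (x ⊲ star e) := by
      rw [h.linner_ract_left]
    rw [h.star_linner, ← h.lact_linner, h.linner_lact, he, h.ract_mul, h2, ← h.norm_sq_linner,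
      h.norm_sq_rinner y, he, CStarRing.norm_star_mul_self, ← sq, ← mul_pow]
    gcongr
    simpa using h.norm_ract_le x (star e)
  rwa [CStarRing.norm_self_mul_star, ← sq, ← mul_pow] at h1

lemma norm_actCol_le (m : Linking A B X) (ξ : LinkingColumn A B X) :
    ‖actCol m ξ‖ ≤ (‖m.a‖ + ‖m.x‖ + ‖m.y‖ + ‖m.b‖) * ‖ξ‖ := by
  have h1 := LinkingColumn.norm_x_le ξ
  have h2 := LinkingColumn.norm_b_le ξ
  calc _ ≤ ‖(actCol m ξ).x‖ + ‖(actCol m ξ).b‖ := LinkingColumn.norm_le _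
    _ ≤ (‖m.a‖ * ‖ξ.x‖ + ‖m.x‖ * ‖ξ.b‖) + (‖m.y‖ * ‖ξ.x‖ + ‖m.b‖ * ‖ξ.b‖) := by
      refine add_le_add ((norm_add_le _ _).trans (add_le_add ?_ ?_))
        ((norm_add_le _ _).trans (add_le_add ?_ ?_))
      · exact h.norm_lact_le _ _
      · exact h.norm_ract_le _ _
      · exact norm_rinner_le h _ _
      · exact norm_mul_le _ _
    _ ≤ (‖m.a‖ * ‖ξ‖ + ‖m.x‖ * ‖ξ‖) + (‖m.y‖ * ‖ξ‖ + ‖m.b‖ * ‖ξ‖) := by gcongr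
    _ = _ := by ring

variable (A B X) in
/-- The representation of the linking algebra by bounded operators on the columns. -/
noncomputable def rep :
    Linking A B X →ₙ+* (LinkingColumn A B X →L[ℂ] LinkingColumn A B X) where
  toFun m := (actCol m).mkContinuous _ (norm_actCol_le m)
  map_mul' m n := by ext1 ξ; exact actCol_mul m n ξ
  map_zero' := by
    ext1 ξ
    change actCol 0 ξ = 0
    ext <;> simp [h.zero_lact, h.zero_ract, h.zero_rinner]
  map_add' m n := by ext1 ξ; exact actCol_add m n ξ

lemma rep_apply (m : Linking A B X) (ξ : LinkingColumn A B X) : rep A B X m ξ = actCol m ξ := rfl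

lemma norm_rep_le (m : Linking A B X) :
    ‖rep A B X m‖ ≤ ‖m.a‖ + ‖m.x‖ + ‖m.y‖ + ‖m.b‖ :=
  LinearMap.mkContinuous_norm_le _ (by positivity) (norm_actCol_le m)

lemma norm_rep_mul_self_le (m : Linking A B X) :
    ‖rep A B X m‖ * ‖rep A B X m‖ ≤ ‖rep A B X (star m * m)‖ := by
  have h1 : ‖rep A B X m‖ ≤ √‖rep A B X (star m * m)‖ := by
    refine ContinuousLinearMap.opNorm_le_bound _ (by positivity) fun ξ => ?_
    refine le_of_sq_le_sq ?_ (by positivity)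
    rw [mul_pow, Real.sq_sqrt (norm_nonneg _), LinkingColumn.norm_sq, rep_apply, inn_actCol,
      ← actCol_mul]
    calc _ ≤ ‖ξ‖ * ‖rep A B X (star m * m) ξ‖ := LinkingColumn.norm_inn_le _ _
      _ ≤ ‖ξ‖ * (‖rep A B X (star m * m)‖ * ‖ξ‖) := by
        gcongr; exact ContinuousLinearMap.le_opNorm _ _
      _ = _ := by ring
  calc _ ≤ √‖rep A B X (star m * m)‖ * √‖rep A B X (star m * m)‖ := by gcongr
    _ = _ := Real.mul_self_sqrt (norm_nonneg _)

lemma norm_rep_star_le (m : Linking A B X) : ‖rep A B X m‖ ≤ ‖rep A B X (star m)‖ := by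
  have h1 := norm_rep_mul_self_le m
  rw [map_mul] at h1
  by_contra! hc
  have h2 := h1.trans (norm_mul_le _ _)
  have h3 : 0 ≤ ‖rep A B X (star m)‖ := norm_nonneg _
  nlinarith

lemma norm_le_of_lact_aux (h : IsImprimitivityBimodule A B X) (k : A) (hk : star k = k) (M : ℝ)
    (hM : 0 < M) (ha : ∀ x : X, ‖k ⊳ x‖ ≤ M * ‖x‖) : ‖k‖ ≤ M := by
  let p : ℕ → A := fun n => Nat.rec k (fun _ q => q * q) n
  have hp0 : p 0 = k := rfl
  have hps : ∀ n, p (n + 1) = p n * p n := fun n => rfl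
  have hpa : ∀ n, star (p n) = p n := by
    intro n
    induction n with
    | zero => exact hk
    | succ n ih => rw [hps, star_mul, ih]
  have hpx : ∀ n (x : X), ‖p n ⊳ x‖ ≤ M ^ 2 ^ n * ‖x‖ := by
    intro n
    induction n with
    | zero => simpa [hp0] using ha
    | succ n ih =>
      intro x
      rw [hps, h.mul_lact, pow_succ, pow_mul, sq, mul_assoc]
      exact (ih _).trans (by gcongr; exact ih _)
  have hd : ∀ d ∈ Submodule.span ℂ {a : A | ∃ x y : X, a = linner A x y},
      ∃ C : ℝ, ∀ n, ‖p n * d‖ ≤ C * M ^ 2 ^ n := by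
    intro d hd
    induction hd using Submodule.span_induction with
    | mem d hd =>
      obtain ⟨x, y, rfl⟩ := hd
      refine ⟨‖x‖ * ‖y‖, fun n => ?_⟩
      rw [← h.lact_linner]
      calc _ ≤ ‖p n ⊳ x‖ * ‖y‖ := norm_linner_le h _ _
        _ ≤ M ^ 2 ^ n * ‖x‖ * ‖y‖ := by gcongr; exact hpx _ _
        _ = _ := by ring
    | zero => exact ⟨0, fun n => by simp⟩
    | add x y _ _ hx hy =>
      obtain ⟨C, hC⟩ := hx
      obtain ⟨D, hD⟩ := hy
      refine ⟨C + D, fun n => ?_⟩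
      rw [mul_add, add_mul]
      exact (norm_add_le _ _).trans (add_le_add (hC n) (hD n))
    | smul c x _ hx =>
      obtain ⟨C, hC⟩ := hx
      refine ⟨‖c‖ * C, fun n => ?_⟩
      rw [mul_smul_comm, norm_smul, mul_assoc]
      gcongr
      exact hC n
  have hpd : ∀ (d : A) (n : ℕ), ‖p n * d‖ ^ 2 ≤ ‖d‖ * ‖p (n + 1) * d‖ := by
    intro d n
    rw [sq, ← CStarRing.norm_star_mul_self, star_mul, hpa, hps, mul_assoc, ← mul_assoc (p n)]
    exact (norm_mul_le _ _).trans (by rw [norm_star])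
  have hkd : ∀ d ∈ Submodule.span ℂ {a : A | ∃ x y : X, a = linner A x y},
      ‖k * d‖ ≤ M * ‖d‖ := by
    intro d hd'
    obtain ⟨C, hC⟩ := hd d hd'
    by_contra! hc
    have hd0 : 0 < ‖d‖ := by
      rw [norm_pos_iff]; rintro rfl; simp at hc
    have h1 : ∀ n, ‖k * d‖ ^ 2 ^ n * ‖d‖ ≤ ‖d‖ ^ 2 ^ n * ‖p n * d‖ := by
      intro n
      induction n with
      | zero => rw [hp0]; simp [mul_comm]
      | succ n ih =>
        refine le_of_mul_le_mul_right (a := ‖d‖) ?_ hd0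
        calc _ = (‖k * d‖ ^ 2 ^ n * ‖d‖) ^ 2 := by ring
          _ ≤ (‖d‖ ^ 2 ^ n * ‖p n * d‖) ^ 2 := by gcongr
          _ = ‖d‖ ^ 2 ^ (n + 1) * ‖p n * d‖ ^ 2 := by ring
          _ ≤ ‖d‖ ^ 2 ^ (n + 1) * (‖d‖ * ‖p (n + 1) * d‖) := by gcongr; exact hpd d n
          _ = _ := by ring
    have hMd : 0 < M * ‖d‖ := by positivity
    have h2 : ∀ n : ℕ, (‖k * d‖ / (M * ‖d‖)) ^ 2 ^ n ≤ C / ‖d‖ := by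
      intro n
      rw [div_pow, div_le_div_iff₀ (by positivity) hd0]
      calc _ ≤ ‖d‖ ^ 2 ^ n * ‖p n * d‖ := h1 n
        _ ≤ ‖d‖ ^ 2 ^ n * (C * M ^ 2 ^ n) := by gcongr; exact hC n
        _ = _ := by ring
    have hr : 1 < ‖k * d‖ / (M * ‖d‖) := by rwa [one_lt_div hMd]
    obtain ⟨n, hn⟩ := pow_unbounded_of_one_lt (C / ‖d‖) hr
    have h3 := pow_le_pow_right₀ hr.le (Nat.lt_two_pow_self (n := n)).le
    linarith [h2 n]
  have hall : ∀ d ∈ closure (Submodule.span ℂ {a : A | ∃ x y : X, a = linner A x y} : Set A),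
      ‖k * d‖ ≤ M * ‖d‖ := fun d hd =>
    closure_minimal (t := {d : A | ‖k * d‖ ≤ M * ‖d‖}) hkd
      (isClosed_le (by fun_prop) (by fun_prop)) hd
  have h4 := hall (star k) (by rw [h.left_full]; trivial)
  rw [CStarRing.norm_self_mul_star, norm_star] at h4
  by_contra! hc
  nlinarith

/-- The left action of `A` on `X` is isometric. -/
lemma norm_le_of_lact (h : IsImprimitivityBimodule A B X) (a : A) (M : ℝ) (hM : 0 ≤ M)
    (ha : ∀ x : X, ‖a ⊳ x‖ ≤ M * ‖x‖) (ha' : ∀ x : X, ‖star a ⊳ x‖ ≤ M * ‖x‖) : ‖a‖ ≤ M := by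
  refine le_of_forall_gt_imp_ge_of_dense fun N hN => ?_
  have hN0 : 0 < N := hM.trans_lt hN
  refine le_of_sq_le_sq ?_ hN0.le
  rw [sq, ← CStarRing.norm_star_mul_self]
  refine norm_le_of_lact_aux h _ (by simp) _ (by positivity) fun x => ?_
  rw [h.mul_lact]
  calc _ ≤ M * ‖a ⊳ x‖ := ha' _
    _ ≤ M * (M * ‖x‖) := by gcongr; exact ha _
    _ ≤ N * (N * ‖x‖) := by gcongr
    _ = _ := by ring

lemma norm_b_le (m : Linking A B X) : ‖m.b‖ ≤ ‖rep A B X m‖ := by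
  have h1 := (rep A B X m).le_opNorm ⟨0, star m.b⟩
  have h2 := LinkingColumn.norm_b_le (rep A B X m ⟨0, star m.b⟩)
  have h3 := LinkingColumn.norm_le (⟨0, star m.b⟩ : LinkingColumn A B X)
  rw [rep_apply] at h1 h2
  simp [h.rinner_zero, CStarRing.norm_self_mul_star] at h1 h2 h3
  by_contra! hc
  have := norm_nonneg (rep A B X m)
  have h4 := h2.trans (h1.trans (mul_le_mul_of_nonneg_left h3 this))
  nlinarith

lemma norm_y_le (m : Linking A B X) : ‖m.y‖ ≤ ‖rep A B X m‖ := by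
  have h1 := (rep A B X m).le_opNorm ⟨m.y, 0⟩
  have h2 := LinkingColumn.norm_b_le (rep A B X m ⟨m.y, 0⟩)
  have h3 := LinkingColumn.norm_le (⟨m.y, 0⟩ : LinkingColumn A B X)
  rw [rep_apply] at h1 h2
  simp [← h.norm_sq_rinner] at h1 h2 h3
  by_contra! hc
  have := norm_nonneg (rep A B X m)
  have h4 := h2.trans (h1.trans (mul_le_mul_of_nonneg_left h3 this))
  nlinarith

lemma norm_x_le (m : Linking A B X) : ‖m.x‖ ≤ ‖rep A B X m‖ := by
  have h1 := norm_y_le (star m)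
  have h2 := norm_rep_star_le (star m)
  rw [star_star] at h2
  exact h1.trans h2

lemma norm_lact_le_rep (m : Linking A B X) (x : X) : ‖m.a ⊳ x‖ ≤ ‖rep A B X m‖ * ‖x‖ := by
  have h1 := (rep A B X m).le_opNorm ⟨x, 0⟩
  have h2 := LinkingColumn.norm_x_le (rep A B X m ⟨x, 0⟩)
  have h3 := LinkingColumn.norm_le (⟨x, 0⟩ : LinkingColumn A B X)
  rw [rep_apply] at h1 h2
  simp only [actCol_x, h.ract_zero, add_zero, norm_zero] at h1 h2 h3
  exact h2.trans (h1.trans (by gcongr))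

lemma norm_a_le (m : Linking A B X) : ‖m.a‖ ≤ ‖rep A B X m‖ := by
  refine norm_le_of_lact h _ _ (norm_nonneg _) (norm_lact_le_rep m) fun x => ?_
  refine (norm_lact_le_rep (star m) x).trans ?_
  gcongr
  simpa using norm_rep_star_le (star m)

variable (A B X) in
lemma rep_injective : Function.Injective (rep A B X) := by
  rw [injective_iff_map_eq_zero]
  intro m hm
  have h1 := norm_a_le m
  have h2 := norm_x_le m
  have h3 := norm_y_le m
  have h4 := norm_b_le m
  rw [hm] at h1 h2 h3 h4
  simp only [norm_zero, norm_le_zero_iff] at h1 h2 h3 h4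
  ext <;> assumption

/-- The norm of the linking algebra is the operator norm on the Hilbert module of columns. -/
noncomputable instance : NonUnitalNormedRing (Linking A B X) :=
  NonUnitalNormedRing.induced _ _ (rep A B X) (rep_injective A B X)

lemma norm_def (m : Linking A B X) : ‖m‖ = ‖rep A B X m‖ := rfl

lemma exists_tendsto {E : Type*} [NormedAddCommGroup E] [CompleteSpace E]
    (f : Linking A B X → E) (hf : ∀ m n, f (m - n) = f m - f n) (hb : ∀ m, ‖f m‖ ≤ ‖m‖)
    (u : ℕ → Linking A B X) (hu : CauchySeq u) :
    ∃ l, Filter.Tendsto (fun k => f (u k)) Filter.atTop (nhds l) := by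
  refine cauchySeq_tendsto_of_complete (hu.map ?_)
  refine LipschitzWith.uniformContinuous (K := 1) (LipschitzWith.of_dist_le_mul fun m n => ?_)
  simpa [dist_eq_norm, hf] using hb (m - n)

lemma norm_sub_le (m n : Linking A B X) :
    ‖m - n‖ ≤ ‖m.a - n.a‖ + ‖m.x - n.x‖ + ‖m.y - n.y‖ + ‖m.b - n.b‖ := norm_rep_le (m - n)

lemma tendsto_of_entries (u : ℕ → Linking A B X) (l : Linking A B X)
    (ha : Filter.Tendsto (fun k => (u k).a) Filter.atTop (nhds l.a))
    (hx : Filter.Tendsto (fun k => (u k).x) Filter.atTop (nhds l.x))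
    (hy : Filter.Tendsto (fun k => (u k).y) Filter.atTop (nhds l.y))
    (hb : Filter.Tendsto (fun k => (u k).b) Filter.atTop (nhds l.b)) :
    Filter.Tendsto u Filter.atTop (nhds l) := by
  rw [tendsto_iff_norm_sub_tendsto_zero] at ha hx hy hb ⊢
  refine squeeze_zero (fun _ => norm_nonneg _) (fun k => norm_sub_le (u k) l) ?_
  simpa only [add_zero] using ((ha.add hx).add hy).add hb

instance : CompleteSpace (Linking A B X) := by
  have := h.complete
  refine Metric.complete_of_cauchySeq_tendsto fun u hu => ?_
  obtain ⟨a, ha⟩ := exists_tendsto Linking.a (fun _ _ => rfl) (fun m => norm_a_le m) u hu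
  obtain ⟨x, hx⟩ := exists_tendsto Linking.x (fun _ _ => rfl) (fun m => norm_x_le m) u hu
  obtain ⟨y, hy⟩ := exists_tendsto Linking.y (fun _ _ => rfl) (fun m => norm_y_le m) u hu
  obtain ⟨b, hb⟩ := exists_tendsto Linking.b (fun _ _ => rfl) (fun m => norm_b_le m) u hu
  exact ⟨⟨a, x, y, b⟩, tendsto_of_entries u ⟨a, x, y, b⟩ ha hx hy hb⟩

noncomputable instance : NonUnitalCStarAlgebra (Linking A B X) where
  norm_mul_self_le m := norm_rep_mul_self_le m
  norm_smul_le c m := by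
    refine ContinuousLinearMap.opNorm_le_bound _ (by positivity) fun ξ => ?_
    have h1 : rep A B X (c • m) ξ = c • rep A B X m ξ := by
      rw [rep_apply, rep_apply]
      ext <;> simp [h.smul_lact, h.smul_ract, h.smul_rinner, smul_mul_assoc]
    rw [h1, norm_smul, mul_assoc]
    gcongr
    exact ContinuousLinearMap.le_opNorm _ _

end Linking

namespace ClosedIdeal

variable {A B X : Type*} [NonUnitalCStarAlgebra A] [NonUnitalCStarAlgebra B]
  [NormedAddCommGroup X] [NormedSpace ℂ X] [LeftInnerData A X] [RightInnerData B X]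

variable (X) in
/-- The closed submodule `I · X` of `X`. (By the Cohen–Hewitt theorem every element of the closed
span of the products `a · x` is itself such a product.) -/
def lsub (I : ClosedIdeal A) : Submodule ℂ X :=
  (Submodule.span ℂ {z : X | ∃ a ∈ I, ∃ x : X, z = a ⊳ x}).topologicalClosure

variable (X) in
/-- The closed submodule `X · J` of `X`. -/
def rsub (J : ClosedIdeal B) : Submodule ℂ X :=
  (Submodule.span ℂ {z : X | ∃ b ∈ J, ∃ x : X, z = x ⊲ b}).topologicalClosure

/-- The product `m · x` of a multiplier `m` of `I` and `x ∈ I · X`: the unique `y ∈ I · X` such that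
`c · y = (c m) · x` for all `c ∈ I`; see `lmul_mem`, `lact_lmul`, `lmul_unique`, `lmul_lact`. -/
noncomputable def lmul (I : ClosedIdeal A) (m : I.Mult) (x : X) : X :=
  Classical.epsilon fun y => y ∈ I.lsub X ∧ ∀ c : I, (c : A) ⊳ y = (m.snd c : A) ⊳ x

/-- The product `x · m` of `x ∈ X · J` and a multiplier `m` of `J`: the unique `y ∈ X · J` such that
`y · c = x · (m c)` for all `c ∈ J`; see `rmul_mem`, `rmul_ract`, `rmul_unique`, `ract_rmul`. -/
noncomputable def rmul (J : ClosedIdeal B) (x : X) (m : J.Mult) : X :=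
  Classical.epsilon fun y => y ∈ J.rsub X ∧ ∀ c : J, y ⊲ (c : B) = x ⊲ (m.fst c : B)

lemma mult_fst_mul (I : ClosedIdeal A) (m : I.Mult) (a b : I) : m.fst (a * b) = m.fst a * b := by
  rw [← sub_eq_zero, ← CStarRing.star_mul_self_eq_zero_iff, mul_sub, ← m.central, ← mul_assoc,
    ← mul_assoc, ← m.central, sub_self]

lemma mult_snd_mul (I : ClosedIdeal A) (m : I.Mult) (a b : I) : m.snd (a * b) = a * m.snd b := by
  rw [← sub_eq_zero, ← CStarRing.mul_star_self_eq_zero_iff, sub_mul, m.central, mul_assoc,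
    mul_assoc, m.central, sub_self]

lemma exists_limit_of_closure {I : Type*} [CompleteSpace X] (l : Filter I) [l.NeBot]
    (F : I → X →ₗ[ℂ] X) (C : ℝ) (hF : ∀ᶠ e in l, ∀ x, ‖F e x‖ ≤ C * ‖x‖) (G : Set X)
    (hG : ∀ x ∈ G, ∃ y, Filter.Tendsto (fun e => F e x) l (nhds y)) (x : X)
    (hx : x ∈ (Submodule.span ℂ G).topologicalClosure) :
    ∃ y, Filter.Tendsto (fun e => F e x) l (nhds y) := by
  have h1 : ∀ x ∈ Submodule.span ℂ G, ∃ y, Filter.Tendsto (fun e => F e x) l (nhds y) := by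
    intro x hx
    induction hx using Submodule.span_induction with
    | mem x hx => exact hG x hx
    | zero => exact ⟨0, by simp⟩
    | add x y _ _ hx hy =>
      obtain ⟨a, ha⟩ := hx
      obtain ⟨b, hb⟩ := hy
      exact ⟨a + b, by simpa using ha.add hb⟩
    | smul c x _ hx =>
      obtain ⟨a, ha⟩ := hx
      exact ⟨c • a, by simpa using ha.const_smul c⟩
  suffices h2 : Cauchy (Filter.map (fun e => F e x) l) by
    obtain ⟨y, hy⟩ := CompleteSpace.complete h2
    exact ⟨y, hy⟩
  rw [Metric.cauchy_iff]
  refine ⟨inferInstance, fun ε hε => ?_⟩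
  obtain ⟨e₀, he₀⟩ := hF.exists
  obtain ⟨z, hz, hxz⟩ := Metric.mem_closure_iff.1 hx (ε / (4 * (|C| + 1))) (by positivity)
  obtain ⟨y, hy⟩ := h1 z hz
  have hCz : |C| * ‖x - z‖ < ε / 4 := by
    rw [dist_eq_norm, lt_div_iff₀ (by positivity)] at hxz
    nlinarith [norm_nonneg (x - z), abs_nonneg C]
  have hev : ∀ᶠ e in l, dist (F e x) y < ε / 2 := by
    filter_upwards [hF, Metric.tendsto_nhds.1 hy (ε / 4) (by positivity)] with e he he'
    have h3 : dist (F e x) (F e z) < ε / 4 := by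
      rw [dist_eq_norm, ← map_sub]
      refine ((he _).trans ?_).trans_lt hCz
      gcongr
      exact le_abs_self C
    linarith [dist_triangle (F e x) (F e z) y]
  refine ⟨(fun e => F e x) '' {e | dist (F e x) y < ε / 2}, Filter.image_mem_map hev, ?_⟩
  rintro _ ⟨e, he, rfl⟩ _ ⟨e', he', rfl⟩
  simp only [Set.mem_ofPred_eq] at he he'
  linarith [dist_triangle_right (F e x) (F e' x) y]

lemma exists_approximateUnit (D : Type*) [NonUnitalCStarAlgebra D] :
    ∃ l : Filter D, l.IsApproximateUnit ∧ ∀ᶠ e in l, ‖e‖ ≤ 1 := by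
  let _ := CStarAlgebra.spectralOrder D
  let _ := CStarAlgebra.spectralOrderedRing D
  have hl := CStarAlgebra.increasingApproximateUnit D
  exact ⟨_, hl.toIsApproximateUnit, hl.eventually_norm⟩

lemma exists_lmul (h : IsImprimitivityBimodule A B X) (I : ClosedIdeal A) (m : I.Mult) (x : X)
    (hx : x ∈ I.lsub X) :
    ∃ y, y ∈ I.lsub X ∧ ∀ c : I, (c : A) ⊳ y = (m.snd c : A) ⊳ x := by
  have := h.complete
  obtain ⟨l, hl, hl1⟩ := exists_approximateUnit I
  have := hl.neBot
  have hcont : ∀ z : X, Continuous fun a : A => a ⊳ z := fun z =>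
    (LinearMap.mkContinuous (σ := RingHom.id ℂ)
      ⟨⟨fun a : A => a ⊳ z, fun a b => h.add_lact a b z⟩, fun c a => h.smul_lact c a z⟩ ‖z‖
      (fun a => (h.norm_lact_le a z).trans (mul_comm _ _).le)).continuous
  have hcont' : ∀ a : A, Continuous fun z : X => a ⊳ z := fun a =>
    (LinearMap.mkContinuous (σ := RingHom.id ℂ)
      ⟨⟨fun z : X => a ⊳ z, fun z w => h.lact_add a z w⟩, fun c z => h.lact_smul c a z⟩ ‖a‖
      (fun z => h.norm_lact_le a z)).continuous
  obtain ⟨y, hy⟩ := exists_limit_of_closure l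
    (fun e : I => ⟨⟨fun z : X => (m.fst e : A) ⊳ z, fun z w => h.lact_add _ z w⟩,
      fun c z => h.lact_smul c _ z⟩) ‖m.fst‖ (by
        filter_upwards [hl1] with e he z
        refine (h.norm_lact_le _ z).trans ?_
        gcongr
        exact (m.fst.le_opNorm e).trans (by nlinarith [norm_nonneg m.fst]))
    {z : X | ∃ a ∈ I, ∃ x : X, z = a ⊳ x} (by
      rintro _ ⟨a, ha, z, rfl⟩
      refine ⟨(m.fst ⟨a, ha⟩ : A) ⊳ z, ?_⟩
      have h1 : Filter.Tendsto (fun e : I => (m.fst (e * ⟨a, ha⟩) : A) ⊳ z) l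
          (nhds ((m.fst ⟨a, ha⟩ : A) ⊳ z)) :=
        (((hcont z).comp continuous_subtype_val).comp m.fst.continuous).continuousAt.tendsto.comp
          (hl.tendsto_mul_right ⟨a, ha⟩)
      refine h1.congr fun e => ?_
      rw [mult_fst_mul]
      exact h.mul_lact _ _ _) x hx
  simp only [LinearMap.coe_mk, AddHom.coe_mk] at hy
  refine ⟨y, ?_, fun c => ?_⟩
  · refine (Submodule.isClosed_topologicalClosure _).mem_of_tendsto hy (.of_forall fun e => ?_)
    exact Submodule.le_topologicalClosure _ (Submodule.subset_span ⟨_, (m.fst e).2, _, rfl⟩)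
  · refine tendsto_nhds_unique (((hcont' c).tendsto y).comp hy) ?_
    have h1 : Filter.Tendsto (fun e : I => ((m.snd c * e : I) : A) ⊳ x) l
        (nhds ((m.snd c : A) ⊳ x)) :=
      ((hcont x).comp continuous_subtype_val).continuousAt.tendsto.comp
        (hl.tendsto_mul_left (m.snd c))
    refine h1.congr fun e => ?_
    rw [m.central]
    exact h.mul_lact _ _ _

lemma exists_rmul (h : IsImprimitivityBimodule A B X) (J : ClosedIdeal B) (m : J.Mult) (x : X)
    (hx : x ∈ J.rsub X) :
    ∃ y, y ∈ J.rsub X ∧ ∀ c : J, y ⊲ (c : B) = x ⊲ (m.fst c : B) := by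
  have := h.complete
  obtain ⟨l, hl, hl1⟩ := exists_approximateUnit J
  have := hl.neBot
  have hcont : ∀ z : X, Continuous fun b : B => z ⊲ b := fun z =>
    (LinearMap.mkContinuous (σ := RingHom.id ℂ)
      ⟨⟨fun b : B => z ⊲ b, fun a b => h.ract_add z a b⟩, fun c b => h.ract_smul c z b⟩ ‖z‖
      (fun b => h.norm_ract_le z b)).continuous
  have hcont' : ∀ b : B, Continuous fun z : X => z ⊲ b := fun b =>
    (LinearMap.mkContinuous (σ := RingHom.id ℂ)
      ⟨⟨fun z : X => z ⊲ b, fun z w => h.add_ract z w b⟩, fun c z => h.smul_ract c z b⟩ ‖b‖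
      (fun z => (h.norm_ract_le z b).trans (mul_comm _ _).le)).continuous
  obtain ⟨y, hy⟩ := exists_limit_of_closure l
    (fun e : J => ⟨⟨fun z : X => z ⊲ (m.snd e : B), fun z w => h.add_ract z w _⟩,
      fun c z => h.smul_ract c z _⟩) ‖m.snd‖ (by
        filter_upwards [hl1] with e he z
        refine (h.norm_ract_le z _).trans ((mul_comm _ _).le.trans ?_)
        gcongr
        exact (m.snd.le_opNorm e).trans (by nlinarith [norm_nonneg m.snd]))
    {z : X | ∃ b ∈ J, ∃ x : X, z = x ⊲ b} (by
      rintro _ ⟨b, hb, z, rfl⟩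
      refine ⟨z ⊲ (m.snd ⟨b, hb⟩ : B), ?_⟩
      have h1 : Filter.Tendsto (fun e : J => z ⊲ (m.snd (⟨b, hb⟩ * e) : B)) l
          (nhds (z ⊲ (m.snd ⟨b, hb⟩ : B))) :=
        (((hcont z).comp continuous_subtype_val).comp m.snd.continuous).continuousAt.tendsto.comp
          (hl.tendsto_mul_left ⟨b, hb⟩)
      refine h1.congr fun e => ?_
      rw [mult_snd_mul]
      exact h.ract_mul _ _ _) x hx
  simp only [LinearMap.coe_mk, AddHom.coe_mk] at hy
  refine ⟨y, ?_, fun c => ?_⟩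
  · refine (Submodule.isClosed_topologicalClosure _).mem_of_tendsto hy (.of_forall fun e => ?_)
    exact Submodule.le_topologicalClosure _ (Submodule.subset_span ⟨_, (m.snd e).2, _, rfl⟩)
  · refine tendsto_nhds_unique (((hcont' c).tendsto y).comp hy) ?_
    have h1 : Filter.Tendsto (fun e : J => x ⊲ ((e * m.fst c : J) : B)) l
        (nhds (x ⊲ (m.fst c : B))) :=
      ((hcont x).comp continuous_subtype_val).continuousAt.tendsto.comp
        (hl.tendsto_mul_right (m.fst c))
    refine h1.congr fun e => ?_
    rw [← m.central]
    exact h.ract_mul _ _ _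

lemma lmul_mem (h : IsImprimitivityBimodule A B X) (I : ClosedIdeal A) (m : I.Mult) {x : X}
    (hx : x ∈ I.lsub X) : I.lmul m x ∈ I.lsub X :=
  (Classical.epsilon_spec (exists_lmul h I m x hx)).1

lemma lact_lmul (h : IsImprimitivityBimodule A B X) (I : ClosedIdeal A) (m : I.Mult) {x : X}
    (hx : x ∈ I.lsub X) (c : I) : (c : A) ⊳ I.lmul m x = (m.snd c : A) ⊳ x :=
  (Classical.epsilon_spec (exists_lmul h I m x hx)).2 c

lemma rmul_mem (h : IsImprimitivityBimodule A B X) (J : ClosedIdeal B) (m : J.Mult) {x : X}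
    (hx : x ∈ J.rsub X) : J.rmul x m ∈ J.rsub X :=
  (Classical.epsilon_spec (exists_rmul h J m x hx)).1

lemma rmul_ract (h : IsImprimitivityBimodule A B X) (J : ClosedIdeal B) (m : J.Mult) {x : X}
    (hx : x ∈ J.rsub X) (c : J) : J.rmul x m ⊲ (c : B) = x ⊲ (m.fst c : B) :=
  (Classical.epsilon_spec (exists_rmul h J m x hx)).2 c

lemma lmul_unique (h : IsImprimitivityBimodule A B X) (I : ClosedIdeal A) (m : I.Mult) {x y : X}
    (hx : x ∈ I.lsub X) (hy : y ∈ I.lsub X) (hc : ∀ c : I, (c : A) ⊳ y = (m.snd c : A) ⊳ x) :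
    y = I.lmul m x := by
  have hd : y - I.lmul m x ∈ I.lsub X := sub_mem hy (lmul_mem h I m hx)
  have hc' : ∀ c ∈ I, c ⊳ (y - I.lmul m x) = 0 := fun c hcI => by
    rw [sub_eq_add_neg, h.lact_add, h.lact_neg, hc ⟨c, hcI⟩, ← lact_lmul h I m hx, add_neg_cancel]
  rw [← sub_eq_zero]
  generalize y - I.lmul m x = d at hd hc'
  have hcont : Continuous fun z : X => rinner B z d := by
    let f : X →ₗ⋆[ℂ] B := ⟨⟨fun z => rinner B z d, fun z w => h.add_rinner z w d⟩,
      fun c z => h.smul_rinner c z d⟩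
    exact (LinearMap.mkContinuous f ‖d‖ fun z =>
      (Linking.norm_rinner_le h z d).trans (mul_comm _ _).le).continuous
  refine h.rinner_self_eq_zero _ (closure_minimal (t := {z : X | rinner B z d = 0}) ?_
    (isClosed_eq hcont continuous_const) hd)
  intro z hz
  induction hz using Submodule.span_induction with
  | mem z hz =>
    obtain ⟨a, ha, w, rfl⟩ := hz
    rw [Set.mem_ofPred_eq, h.rinner_lact_left, hc' _ (star_mem ha), h.rinner_zero]
  | zero => exact h.zero_rinner d
  | add z w _ _ hz hw =>
    rw [Set.mem_ofPred_eq] at *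
    rw [h.add_rinner, hz, hw, add_zero]
  | smul c z _ hz =>
    rw [Set.mem_ofPred_eq] at *
    rw [h.smul_rinner, hz, smul_zero]

lemma rmul_unique (h : IsImprimitivityBimodule A B X) (J : ClosedIdeal B) (m : J.Mult) {x y : X}
    (hx : x ∈ J.rsub X) (hy : y ∈ J.rsub X) (hc : ∀ c : J, y ⊲ (c : B) = x ⊲ (m.fst c : B)) :
    y = J.rmul x m := by
  have hd : y - J.rmul x m ∈ J.rsub X := sub_mem hy (rmul_mem h J m hx)
  have hc' : ∀ c ∈ J, (y - J.rmul x m) ⊲ c = 0 := fun c hcJ => by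
    have h0 : (-J.rmul x m) ⊲ c = -(J.rmul x m ⊲ c) := by
      simpa using h.smul_ract (-1 : ℂ) (J.rmul x m) c
    rw [sub_eq_add_neg, h.add_ract, h0, hc ⟨c, hcJ⟩, ← rmul_ract h J m hx, add_neg_cancel]
  rw [← sub_eq_zero]
  generalize y - J.rmul x m = d at hd hc'
  have hcont : Continuous fun z : X => linner A z d := by
    let f : X →ₗ[ℂ] A := ⟨⟨fun z => linner A z d, fun z w => h.add_linner z w d⟩,
      fun c z => h.smul_linner c z d⟩
    exact (LinearMap.mkContinuous f ‖d‖ fun z =>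
      (Linking.norm_linner_le h z d).trans (mul_comm _ _).le).continuous
  refine h.linner_self_eq_zero _ (closure_minimal (t := {z : X | linner A z d = 0}) ?_
    (isClosed_eq hcont continuous_const) hd)
  intro z hz
  induction hz using Submodule.span_induction with
  | mem z hz =>
    obtain ⟨b, hb, w, rfl⟩ := hz
    rw [Set.mem_ofPred_eq, h.linner_ract_left, hc' _ (star_mem hb), h.linner_zero]
  | zero => exact h.zero_linner d
  | add z w _ _ hz hw =>
    rw [Set.mem_ofPred_eq] at *
    rw [h.add_linner, hz, hw, add_zero]
  | smul c z _ hz =>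
    rw [Set.mem_ofPred_eq] at *
    rw [h.smul_linner, hz, smul_zero]

lemma lact_mem_lsub (I : ClosedIdeal A) (a : I) (x : X) : (a : A) ⊳ x ∈ I.lsub X :=
  Submodule.le_topologicalClosure _ (Submodule.subset_span ⟨_, a.2, _, rfl⟩)

lemma ract_mem_rsub (J : ClosedIdeal B) (b : J) (x : X) : x ⊲ (b : B) ∈ J.rsub X :=
  Submodule.le_topologicalClosure _ (Submodule.subset_span ⟨_, b.2, _, rfl⟩)

/-- `m · (a · x) = (m a) · x`. -/
lemma lmul_lact (h : IsImprimitivityBimodule A B X) (I : ClosedIdeal A) (m : I.Mult) (a : I)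
    (x : X) : I.lmul m ((a : A) ⊳ x) = (m.fst a : A) ⊳ x := by
  refine (lmul_unique h I m (lact_mem_lsub I a x) (lact_mem_lsub I _ x) fun c => ?_).symm
  rw [← h.mul_lact, ← h.mul_lact]
  exact congrArg (fun d : I => (d : A) ⊳ x) (m.central c a).symm

/-- `(x · b) · m = x · (b m)`. -/
lemma ract_rmul (h : IsImprimitivityBimodule A B X) (J : ClosedIdeal B) (m : J.Mult) (b : J)
    (x : X) : J.rmul (x ⊲ (b : B)) m = x ⊲ (m.snd b : B) := by
  refine (rmul_unique h J m (ract_mem_rsub J b x) (ract_mem_rsub J _ x) fun c => ?_).symm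
  rw [← h.ract_mul, ← h.ract_mul]
  exact congrArg (fun d : J => x ⊲ (d : B)) (m.central b c)

end ClosedIdeal

section Morita

variable {A B X : Type*} [NonUnitalCStarAlgebra A] [NonUnitalCStarAlgebra B]
  [NormedAddCommGroup X] [NormedSpace ℂ X] [LeftInnerData A X] [RightInnerData B X]

/-- The closed subbimodule `Y` of `X` is, with the restricted operations, an `I`–`J`
imprimitivity bimodule. -/
structure IsImprimitivitySubbimodule (I : ClosedIdeal A) (Y : Submodule ℂ X) (J : ClosedIdeal B) :
    Prop where
  isClosed : IsClosed (Y : Set X)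
  lact_mem : ∀ (a : A) (y : X), y ∈ Y → a ⊳ y ∈ Y
  ract_mem : ∀ (y : X) (b : B), y ∈ Y → y ⊲ b ∈ Y
  left_full : (I : Set A) =
    closure (Submodule.span ℂ {a : A | ∃ x ∈ Y, ∃ y ∈ Y, a = linner A x y} : Set A)
  right_full : (J : Set B) =
    closure (Submodule.span ℂ {b : B | ∃ x ∈ Y, ∃ y ∈ Y, b = rinner B x y} : Set B)

/-- `(φA, φ, φB)` is a partial automorphism of the imprimitivity bimodule `X`, that is, an
isomorphism from the imprimitivity subbimodule `Y₁` (over `I₁` and `J₁`) onto the imprimitivity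
subbimodule `Y₂` (over `I₂` and `J₂`). -/
structure IsPartialAutomorphism {I₁ I₂ : ClosedIdeal A} {Y₁ Y₂ : Submodule ℂ X}
    {J₁ J₂ : ClosedIdeal B} (φA : I₁ ≃⋆ₐ[ℂ] I₂) (φ : Y₁ → Y₂) (φB : J₁ ≃⋆ₐ[ℂ] J₂) : Prop where
  source : IsImprimitivitySubbimodule I₁ Y₁ J₁
  target : IsImprimitivitySubbimodule I₂ Y₂ J₂
  map_ract : ∀ (x : Y₁) (b : J₁) (hx : (x : X) ⊲ (b : B) ∈ Y₁),
    (φ ⟨(x : X) ⊲ (b : B), hx⟩ : X) = (φ x : X) ⊲ (φB b : B)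
  map_rinner : ∀ (x y : Y₁) (hxy : rinner B (x : X) (y : X) ∈ J₁),
    (φB ⟨rinner B (x : X) (y : X), hxy⟩ : B) = rinner B (φ x : X) (φ y : X)
  map_lact : ∀ (a : I₁) (x : Y₁) (hx : (a : A) ⊳ (x : X) ∈ Y₁),
    (φ ⟨(a : A) ⊳ (x : X), hx⟩ : X) = (φA a : A) ⊳ (φ x : X)
  map_linner : ∀ (x y : Y₁) (hxy : linner A (x : X) (y : X) ∈ I₁),
    (φA ⟨linner A (x : X) (y : X), hxy⟩ : A) = linner A (φ x : X) (φ y : X)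
  surjective : Function.Surjective φ

variable {S : Type*} [InverseMonoid S]

variable (X) in
/-- A Morita equivalence `(X, φ)` between the Busby–Smith twisted actions `(A, S, α, u)` and
`(B, S, β, v)`. -/
structure TwistedMoritaEquivalence (𝒜 : TwistedAction S A) (ℬ : TwistedAction S B) where
  imprimitivity : IsImprimitivityBimodule A B X
  /-- `X_s := A_s · X = X · B_s`. -/
  sub_eq : ∀ s : S, (𝒜.ideal s).lsub X = (ℬ.ideal s).rsub X
  /-- The maps `φ_s : X_{s^*} → X_s`. -/
  φ : ∀ s : S, (𝒜.ideal s⁻¹).lsub X → (𝒜.ideal s).lsub X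
  isPartialAutomorphism : ∀ s : S, IsPartialAutomorphism (𝒜.map s) (φ s) (ℬ.map s)
  /-- `φ_s φ_t` and `u_{s,t} · φ_{st}(·) · v_{s,t}^*` have the same domain. -/
  dom_comp : ∀ (s t : S) (x : X), x ∈ (𝒜.ideal (s * t)⁻¹).lsub X ↔
    ∃ h : x ∈ (𝒜.ideal t⁻¹).lsub X, (φ t ⟨x, h⟩ : X) ∈ (𝒜.ideal s⁻¹).lsub X
  /-- `φ_s φ_t = u_{s,t} · φ_{st}(·) · v_{s,t}^*`. -/
  φ_comp : ∀ (s t : S) (x : X) (h : x ∈ (𝒜.ideal (s * t)⁻¹).lsub X)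
    (h₁ : x ∈ (𝒜.ideal t⁻¹).lsub X) (h₂ : (φ t ⟨x, h₁⟩ : X) ∈ (𝒜.ideal s⁻¹).lsub X),
    (φ s ⟨φ t ⟨x, h₁⟩, h₂⟩ : X) =
      (ℬ.ideal (s * t)).rmul
        ((𝒜.ideal (s * t)).lmul (𝒜.mult s t : (𝒜.ideal (s * t)).Mult) (φ (s * t) ⟨x, h⟩ : X))
        (star (ℬ.mult s t : (ℬ.ideal (s * t)).Mult))

end Morita

namespace Linking

variable (A B X : Type*) [NonUnitalCStarAlgebra A] [NonUnitalCStarAlgebra B]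
  [NormedAddCommGroup X] [NormedSpace ℂ X] [LeftInnerData A X] [RightInnerData B X]
  [h : IsImprimitivityBimodule A B X]

/-- The corner of the linking algebra which consists of the matrices with rows `0, x` and
`0, b`. It is normed as a subspace of the linking algebra. -/
def corner : Submodule ℂ (Linking A B X) where
  carrier := {c | c.a = 0 ∧ c.y = 0}
  add_mem' := by rintro m n ⟨h₁, h₂⟩ ⟨h₃, h₄⟩; simp [h₁, h₂, h₃, h₄]
  zero_mem' := by simp
  smul_mem' := by rintro c m ⟨h₁, h₂⟩; simp [h₁, h₂]

/-- The linking algebra acts on the corner by multiplication; the inner product is `y z^*`. -/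
instance : LeftInnerData (Linking A B X) (corner A B X) where
  act c y := ⟨c * y, by
    obtain ⟨y, h₁, h₂⟩ := y
    constructor <;> simp [h₁, h₂, h.linner_zero, h.zero_lact, h.zero_ract]⟩
  inner y z := y * star (z : Linking A B X)

/-- `B` acts on the corner on the right, `(x, b) · d = (x · d, b d)`; the inner product of `(x, b)`
and `(z, d)` is `⟨x, z⟩_B + b^* d`. -/
instance : RightInnerData B (corner A B X) where
  act y d := ⟨⟨0, (y : Linking A B X).x ⊲ d, 0, (y : Linking A B X).b * d⟩, rfl, rfl⟩
  inner y z := rinner B (y : Linking A B X).x (z : Linking A B X).x +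
    star (y : Linking A B X).b * (z : Linking A B X).b

end Linking

/-!
Everything about the linking algebra `C` can be checked entry by entry, once enough is known about
the submodules `X_s`, the maps `φ_s` and the action of multipliers on `X_s`.

* A vector `x` lies in `I · X` if and only if `⟨x, x⟩ ∈ I`: with an approximate unit of `I` one sees
  that `e · x → x` (`ClosedIdeal.mem_lsub_iff`). Hence inner products detect membership in the
  entries `X_s` of `C_s`, and every submodule `I · X = X · J` is an `I`–`J` imprimitivity bimodule
  (`ClosedIdeal.isImprimitivitySubbimodule`).
* A pair of maps `L`, `R` on a C⋆-algebra with `R x * y = x * L y` is automatically a multiplier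
  (`DoubleCentralizer.ofCentral`). So only this identity has to be verified to obtain the diagonal
  multiplier with entries `u` and `v` of the ideal `C_s`; on the off-diagonal entries it says that
  the multiplier actions on `X_s` are adjointable for both inner products
  (`ClosedIdeal.linner_rmul`, `ClosedIdeal.rinner_lmul`).
* Since `φ_s` is surjective and preserves inner products, it is linear and injective, so that it is
  an isomorphism `γ_s` of ideals of `C` when it is applied entrywise together with `α_s` and `β_s`
  (`IsPartialAutomorphism.linkingEquiv`).
* The cocycle identity holds on the diagonal entries by hypothesis. On the off-diagonal entries both
  sides lie in `X_r`, and their inner products with the vectors `φ_r(z)`, which exhaust `X_r`, are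
  the two sides of the cocycle identity of `ℬ` at `⟨z, x⟩_B`, or of `𝒜` at `⟨z, y⟩_A`
  (`φ_cocycle_right`, `φ_cocycle_left`).
* The corner `Y` is an imprimitivity bimodule (`Linking.corner_isImprimitivityBimodule`), and
  `C_s · Y` is just `Y ∩ C_s` (`Linking.mem_lsub_corner_iff`). Multipliers of `C_s` act on `Y ∩ C_s`
  as on `C_s`, so the axioms for the restrictions of `γ_s` are those of the action on `C`.
-/

namespace IsImprimitivityBimodule

variable {A B X : Type*} [NonUnitalCStarAlgebra A] [NonUnitalCStarAlgebra B]
  [NormedAddCommGroup X] [NormedSpace ℂ X] [LeftInnerData A X] [RightInnerData B X]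

/-! ### Continuity of the module operations -/

lemma continuous_lact (h : IsImprimitivityBimodule A B X) (a : A) :
    Continuous fun x : X => a ⊳ x :=
  continuous_of_linear_of_bound (h.lact_add a) (fun c x => h.lact_smul c a x) (h.norm_lact_le a)

lemma continuous_ract (h : IsImprimitivityBimodule A B X) (b : B) :
    Continuous fun x : X => x ⊲ b :=
  continuous_of_linear_of_bound (fun x y => h.add_ract x y b) (fun c x => h.smul_ract c x b)
    (fun x => (h.norm_ract_le x b).trans (mul_comm _ _).le)

lemma continuous_linner_left (h : IsImprimitivityBimodule A B X) (y : X) :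
    Continuous fun x : X => linner A x y :=
  continuous_of_linear_of_bound (fun x z => h.add_linner x z y) (fun c x => h.smul_linner c x y)
    (fun x => (Linking.norm_linner_le h x y).trans (mul_comm _ _).le)

lemma continuous_rinner_right (h : IsImprimitivityBimodule A B X) (x : X) :
    Continuous fun y : X => rinner B x y :=
  continuous_of_linear_of_bound (h.rinner_add x) (fun c y => h.rinner_smul c x y)
    (fun y => Linking.norm_rinner_le h x y)

lemma sub_lact (h : IsImprimitivityBimodule A B X) (a b : A) (x : X) :
    (a - b) ⊳ x = a ⊳ x - b ⊳ x := by
  rw [sub_eq_add_neg, h.add_lact, h.neg_lact, sub_eq_add_neg]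

lemma ract_sub (h : IsImprimitivityBimodule A B X) (x : X) (a b : B) :
    x ⊲ (a - b) = x ⊲ a - x ⊲ b := by
  rw [sub_eq_add_neg, h.ract_add, h.ract_neg, sub_eq_add_neg]

lemma linner_sub (h : IsImprimitivityBimodule A B X) (x y z : X) :
    linner A x (y - z) = linner A x y - linner A x z := by
  have h1 := h.linner_smul (-1) x z
  rw [sub_eq_add_neg, h.linner_add, sub_eq_add_neg]
  simpa using h1

lemma sub_linner (h : IsImprimitivityBimodule A B X) (x y z : X) :
    linner A (x - y) z = linner A x z - linner A y z := by
  rw [← h.star_linner, h.linner_sub, star_sub, h.star_linner, h.star_linner]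

lemma rinner_sub (h : IsImprimitivityBimodule A B X) (x y z : X) :
    rinner B x (y - z) = rinner B x y - rinner B x z := by
  have h1 := h.rinner_smul (-1) x z
  rw [sub_eq_add_neg, h.rinner_add, sub_eq_add_neg]
  simpa using h1

lemma sub_rinner (h : IsImprimitivityBimodule A B X) (x y z : X) :
    rinner B (x - y) z = rinner B x z - rinner B y z := by
  rw [← h.star_rinner, h.rinner_sub, star_sub, h.star_rinner, h.star_rinner]

/-- By fullness, a closed additive property of elements of `A` holds everywhere as soon as it holds
for the inner products. -/
lemma linner_induction (h : IsImprimitivityBimodule A B X) {p : A → Prop}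
    (closed : IsClosed {a | p a}) (add : ∀ a b, p a → p b → p (a + b))
    (of_linner : ∀ x y : X, p (linner A x y)) (a : A) : p a := by
  have ha : a ∈ closure (Submodule.span ℂ {a : A | ∃ x y : X, a = linner A x y} : Set A) := by
    rw [h.left_full]; trivial
  refine closure_minimal (t := {a | p a}) (fun b hb => ?_) closed ha
  induction hb using Submodule.closure_induction with
  | zero => rw [Set.mem_ofPred_eq, ← h.zero_linner 0]; exact of_linner _ _
  | add x y _ _ hx hy => exact add _ _ hx hy
  | smul_mem c b hb =>
    obtain ⟨x, y, rfl⟩ := hb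
    rw [Set.mem_ofPred_eq, ← h.smul_linner]
    exact of_linner _ _

lemma rinner_induction (h : IsImprimitivityBimodule A B X) {p : B → Prop}
    (closed : IsClosed {b | p b}) (add : ∀ a b, p a → p b → p (a + b))
    (of_rinner : ∀ x y : X, p (rinner B x y)) (b : B) : p b := by
  have hb : b ∈ closure (Submodule.span ℂ {b : B | ∃ x y : X, b = rinner B x y} : Set B) := by
    rw [h.right_full]; trivial
  refine closure_minimal (t := {b | p b}) (fun b hb => ?_) closed hb
  induction hb using Submodule.closure_induction with
  | zero => rw [Set.mem_ofPred_eq, ← h.rinner_zero 0]; exact of_rinner _ _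
  | add x y _ _ hx hy => exact add _ _ hx hy
  | smul_mem c b hb =>
    obtain ⟨x, y, rfl⟩ := hb
    rw [Set.mem_ofPred_eq, ← h.rinner_smul]
    exact of_rinner _ _

end IsImprimitivityBimodule

namespace ClosedIdeal

/-! ### The submodules `I · X` and `X · J` -/

section Ideal

variable {A : Type*} [NonUnitalCStarAlgebra A]

lemma mul_mem_left (I : ClosedIdeal A) (a : A) {b : A} (hb : b ∈ I) : a * b ∈ I :=
  I.mul_mem_left' a hb

lemma mul_mem_right (I : ClosedIdeal A) {a : A} (b : A) (ha : a ∈ I) : a * b ∈ I :=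
  I.mul_mem_right' b ha

lemma isClosed (I : ClosedIdeal A) : IsClosed {a | a ∈ I} := I.isClosed'

/-- The whole algebra as a closed ideal. -/
instance : Top (ClosedIdeal A) where
  top :=
    { carrier := Set.univ
      zero_mem' := trivial
      add_mem' := fun _ _ => trivial
      smul_mem' := fun _ _ _ => trivial
      star_mem' := fun _ => trivial
      mul_mem_left' := fun _ _ _ => trivial
      mul_mem_right' := fun _ _ => trivial
      isClosed' := isClosed_univ }

lemma mem_top (a : A) : a ∈ (⊤ : ClosedIdeal A) := trivial

/-- The intersection of two closed ideals. -/
instance : Min (ClosedIdeal A) where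
  min I J :=
    { carrier := {a | a ∈ I ∧ a ∈ J}
      zero_mem' := ⟨zero_mem I, zero_mem J⟩
      add_mem' := fun h h' => ⟨add_mem h.1 h'.1, add_mem h.2 h'.2⟩
      smul_mem' := fun c _ h => ⟨SMulMemClass.smul_mem c h.1, SMulMemClass.smul_mem c h.2⟩
      star_mem' := fun h => ⟨star_mem h.1, star_mem h.2⟩
      mul_mem_left' := fun a _ h => ⟨I.mul_mem_left a h.1, J.mul_mem_left a h.2⟩
      mul_mem_right' := fun a h => ⟨I.mul_mem_right a h.1, J.mul_mem_right a h.2⟩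
      isClosed' := I.isClosed.inter J.isClosed }

/-- A closed set contains a given element `a` of `I` if it contains all `a e` with `e ∈ I`. -/
lemma mem_of_mul_mem (I : ClosedIdeal A) {V : Set A} (hV : IsClosed V) {a : A} (ha : a ∈ I)
    (hmem : ∀ e ∈ I, a * e ∈ V) : a ∈ V := by
  obtain ⟨l, hl, -⟩ := exists_approximateUnit I
  have := hl.neBot
  have h1 : Filter.Tendsto (fun e : I => ((⟨a, ha⟩ * e : I) : A)) l (nhds a) :=
    (continuous_subtype_val.tendsto _).comp (hl.tendsto_mul_left (⟨a, ha⟩ : I))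
  exact hV.mem_of_tendsto h1 (.of_forall fun e => hmem e e.2)

lemma mem_of_mul_mem_left (I : ClosedIdeal A) {V : Set A} (hV : IsClosed V) {a : A} (ha : a ∈ I)
    (hmem : ∀ e ∈ I, e * a ∈ V) : a ∈ V := by
  obtain ⟨l, hl, -⟩ := exists_approximateUnit I
  have := hl.neBot
  have h1 : Filter.Tendsto (fun e : I => ((e * ⟨a, ha⟩ : I) : A)) l (nhds a) :=
    (continuous_subtype_val.tendsto _).comp (hl.tendsto_mul_right (⟨a, ha⟩ : I))
  exact hV.mem_of_tendsto h1 (.of_forall fun e => hmem e e.2)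

end Ideal

variable {A B X : Type*} [NonUnitalCStarAlgebra A] [NonUnitalCStarAlgebra B]
  [NormedAddCommGroup X] [NormedSpace ℂ X] [LeftInnerData A X] [RightInnerData B X]

lemma isClosed_lsub (I : ClosedIdeal A) : IsClosed {x | x ∈ I.lsub X} :=
  Submodule.isClosed_topologicalClosure _

lemma isClosed_rsub (J : ClosedIdeal B) : IsClosed {x | x ∈ J.rsub X} :=
  Submodule.isClosed_topologicalClosure _

lemma lsub_induction (h : IsImprimitivityBimodule A B X) (I : ClosedIdeal A) {p : X → Prop}
    (closed : IsClosed {x | p x}) (add : ∀ x y, p x → p y → p (x + y))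
    (lact : ∀ a ∈ I, ∀ x : X, p (a ⊳ x)) {x : X} (hx : x ∈ I.lsub X) : p x := by
  refine closure_minimal (t := {x | p x}) (fun x hx => ?_) closed hx
  induction hx using Submodule.closure_induction with
  | zero => rw [Set.mem_ofPred_eq, ← h.zero_lact 0]; exact lact _ (zero_mem I) _
  | add x y _ _ hx hy => exact add _ _ hx hy
  | smul_mem c x hx =>
    obtain ⟨a, ha, x, rfl⟩ := hx
    rw [Set.mem_ofPred_eq, ← h.lact_smul]
    exact lact _ ha _

lemma rsub_induction (h : IsImprimitivityBimodule A B X) (J : ClosedIdeal B) {p : X → Prop}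
    (closed : IsClosed {x | p x}) (add : ∀ x y, p x → p y → p (x + y))
    (ract : ∀ b ∈ J, ∀ x : X, p (x ⊲ b)) {x : X} (hx : x ∈ J.rsub X) : p x := by
  refine closure_minimal (t := {x | p x}) (fun x hx => ?_) closed hx
  induction hx using Submodule.closure_induction with
  | zero => rw [Set.mem_ofPred_eq, ← h.ract_zero 0]; exact ract _ (zero_mem J) _
  | add x y _ _ hx hy => exact add _ _ hx hy
  | smul_mem c x hx =>
    obtain ⟨b, hb, x, rfl⟩ := hx
    rw [Set.mem_ofPred_eq, ← h.smul_ract]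
    exact ract _ hb _

lemma linner_mem_of_left (h : IsImprimitivityBimodule A B X) (I : ClosedIdeal A) {x : X}
    (hx : x ∈ I.lsub X) (y : X) : linner A x y ∈ I :=
  lsub_induction h I (p := fun x => linner A x y ∈ I)
    (I.isClosed.preimage (h.continuous_linner_left y))
    (fun x z hx hz => by rw [h.add_linner]; exact add_mem hx hz)
    (fun a ha x => by rw [h.lact_linner]; exact I.mul_mem_right _ ha) hx

lemma linner_mem_of_right (h : IsImprimitivityBimodule A B X) (I : ClosedIdeal A) (x : X) {y : X}
    (hy : y ∈ I.lsub X) : linner A x y ∈ I := by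
  rw [← h.star_linner]
  exact star_mem (linner_mem_of_left h I hy x)

lemma rinner_mem_of_right (h : IsImprimitivityBimodule A B X) (J : ClosedIdeal B) (x : X) {y : X}
    (hy : y ∈ J.rsub X) : rinner B x y ∈ J :=
  rsub_induction h J (p := fun y => rinner B x y ∈ J)
    (J.isClosed.preimage (h.continuous_rinner_right x))
    (fun y z hy hz => by rw [h.rinner_add]; exact add_mem hy hz)
    (fun b hb y => by rw [h.rinner_ract]; exact J.mul_mem_left _ hb) hy

lemma rinner_mem_of_left (h : IsImprimitivityBimodule A B X) (J : ClosedIdeal B) {x : X}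
    (hx : x ∈ J.rsub X) (y : X) : rinner B x y ∈ J := by
  rw [← h.star_rinner]
  exact star_mem (rinner_mem_of_right h J y hx)

lemma lact_mem_lsub_of_mem (h : IsImprimitivityBimodule A B X) (I : ClosedIdeal A) (a : A) {x : X}
    (hx : x ∈ I.lsub X) : a ⊳ x ∈ I.lsub X :=
  lsub_induction h I (p := fun x => a ⊳ x ∈ I.lsub X)
    (I.isClosed_lsub.preimage (h.continuous_lact a))
    (fun x y hx hy => by rw [h.lact_add]; exact add_mem hx hy)
    (fun c hc x => by
      rw [← h.mul_lact]; exact lact_mem_lsub I ⟨_, I.mul_mem_left a hc⟩ x) hx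

lemma ract_mem_rsub_of_mem (h : IsImprimitivityBimodule A B X) (J : ClosedIdeal B) (b : B) {x : X}
    (hx : x ∈ J.rsub X) : x ⊲ b ∈ J.rsub X :=
  rsub_induction h J (p := fun x => x ⊲ b ∈ J.rsub X)
    (J.isClosed_rsub.preimage (h.continuous_ract b))
    (fun x y hx hy => by rw [h.add_ract]; exact add_mem hx hy)
    (fun c hc x => by
      rw [← h.ract_mul]; exact ract_mem_rsub J ⟨_, J.mul_mem_right b hc⟩ x) hx

/-- If `⟨x, x⟩ ∈ I` and `e` runs through an approximate unit of `I`, then `e · x → x`, because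
`‖e · x - x‖² = ‖(e k - k) e^* - (e k - k)‖` with `k = ⟨x, x⟩`. -/
lemma mem_of_lact_mem (h : IsImprimitivityBimodule A B X) (I : ClosedIdeal A) {V : Set X}
    (hV : IsClosed V) {x : X} (hx : linner A x x ∈ I) (hmem : ∀ e ∈ I, e ⊳ x ∈ V) : x ∈ V := by
  obtain ⟨l, hl, hl1⟩ := exists_approximateUnit I
  have := hl.neBot
  suffices h1 : Filter.Tendsto (fun e : I => (e : A) ⊳ x) l (nhds x) from
    hV.mem_of_tendsto h1 (.of_forall fun e => hmem e e.2)
  have h2 : Filter.Tendsto (fun e : I => 2 * ‖e * ⟨_, hx⟩ - ⟨_, hx⟩‖) l (nhds 0) := by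
    simpa using (tendsto_iff_norm_sub_tendsto_zero.1 (hl.tendsto_mul_right ⟨_, hx⟩)).const_mul 2
  have h3 : Filter.Tendsto (fun e : I => ‖(e : A) ⊳ x - x‖ ^ 2) l (nhds 0) := by
    refine squeeze_zero' (.of_forall fun e => by positivity) ?_ h2
    filter_upwards [hl1] with e he
    have h4 : linner A ((e : A) ⊳ x - x) ((e : A) ⊳ x - x) =
        (e * linner A x x - linner A x x) * star (e : A)
          - (e * linner A x x - linner A x x) := by
      simp only [h.linner_sub, h.sub_linner, h.lact_linner, h.linner_lact_right]
      noncomm_ring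
    rw [h.norm_sq_linner, h4]
    change _ ≤ 2 * ‖(e : A) * linner A x x - linner A x x‖
    refine (_root_.norm_sub_le _ _).trans ?_
    have h5 := norm_mul_le ((e : A) * linner A x x - linner A x x) (star (e : A))
    rw [norm_star] at h5
    have h6 : ‖(e : A)‖ ≤ 1 := he
    nlinarith [norm_nonneg ((e : A) * linner A x x - linner A x x)]
  rw [tendsto_iff_norm_sub_tendsto_zero]
  simpa using h3.sqrt

lemma mem_of_ract_mem (h : IsImprimitivityBimodule A B X) (J : ClosedIdeal B) {V : Set X}
    (hV : IsClosed V) {x : X} (hx : rinner B x x ∈ J) (hmem : ∀ e ∈ J, x ⊲ e ∈ V) : x ∈ V := by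
  obtain ⟨l, hl, hl1⟩ := exists_approximateUnit J
  have := hl.neBot
  suffices h1 : Filter.Tendsto (fun e : J => x ⊲ (e : B)) l (nhds x) from
    hV.mem_of_tendsto h1 (.of_forall fun e => hmem e e.2)
  have h2 : Filter.Tendsto (fun e : J => 2 * ‖⟨_, hx⟩ * e - ⟨_, hx⟩‖) l (nhds 0) := by
    simpa using (tendsto_iff_norm_sub_tendsto_zero.1 (hl.tendsto_mul_left ⟨_, hx⟩)).const_mul 2
  have h3 : Filter.Tendsto (fun e : J => ‖x ⊲ (e : B) - x‖ ^ 2) l (nhds 0) := by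
    refine squeeze_zero' (.of_forall fun e => by positivity) ?_ h2
    filter_upwards [hl1] with e he
    have h4 : rinner B (x ⊲ (e : B) - x) (x ⊲ (e : B) - x) =
        star (e : B) * (rinner B x x * e - rinner B x x)
          - (rinner B x x * e - rinner B x x) := by
      simp only [h.rinner_sub, h.sub_rinner, h.rinner_ract, h.ract_rinner]
      noncomm_ring
    rw [h.norm_sq_rinner, h4]
    change _ ≤ 2 * ‖rinner B x x * (e : B) - rinner B x x‖
    refine (_root_.norm_sub_le _ _).trans ?_
    have h5 := norm_mul_le (star (e : B)) (rinner B x x * (e : B) - rinner B x x)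
    rw [norm_star] at h5
    have h6 : ‖(e : B)‖ ≤ 1 := he
    nlinarith [norm_nonneg (rinner B x x * (e : B) - rinner B x x)]
  rw [tendsto_iff_norm_sub_tendsto_zero]
  simpa using h3.sqrt

lemma mem_lsub_iff (h : IsImprimitivityBimodule A B X) (I : ClosedIdeal A) {x : X} :
    x ∈ I.lsub X ↔ linner A x x ∈ I :=
  ⟨fun hx => linner_mem_of_left h I hx x, fun hx =>
    mem_of_lact_mem h I I.isClosed_lsub hx fun e he => lact_mem_lsub I ⟨e, he⟩ x⟩

lemma mem_rsub_iff (h : IsImprimitivityBimodule A B X) (J : ClosedIdeal B) {x : X} :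
    x ∈ J.rsub X ↔ rinner B x x ∈ J :=
  ⟨fun hx => rinner_mem_of_left h J hx x, fun hx =>
    mem_of_ract_mem h J J.isClosed_rsub hx fun e he => ract_mem_rsub J ⟨e, he⟩ x⟩

lemma eq_of_linner_left (h : IsImprimitivityBimodule A B X) (I : ClosedIdeal A) {x y : X}
    (hx : x ∈ I.lsub X) (hy : y ∈ I.lsub X)
    (hxy : ∀ z ∈ I.lsub X, linner A z x = linner A z y) : x = y := by
  rw [← sub_eq_zero]
  refine h.linner_self_eq_zero _ ?_
  rw [h.linner_sub, hxy _ (sub_mem hx hy), sub_self]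

lemma eq_of_rinner_left (h : IsImprimitivityBimodule A B X) (I : ClosedIdeal A) {x y : X}
    (hx : x ∈ I.lsub X) (hy : y ∈ I.lsub X)
    (hxy : ∀ z ∈ I.lsub X, rinner B z x = rinner B z y) : x = y := by
  rw [← sub_eq_zero]
  refine h.rinner_self_eq_zero _ ?_
  rw [h.rinner_sub, hxy _ (sub_mem hx hy), sub_self]

/-- If `I · X = X · J`, then this submodule is an `I`–`J` imprimitivity bimodule. An element `a` of
`I` is a limit of elements `e a f` with `e, f ∈ I`, and `e ⟨x, y⟩ f = ⟨e · x, f^* · y⟩`. -/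
lemma isImprimitivitySubbimodule (h : IsImprimitivityBimodule A B X) {I : ClosedIdeal A}
    {J : ClosedIdeal B} (hIJ : I.lsub X = J.rsub X) :
    IsImprimitivitySubbimodule I (I.lsub X) J where
  isClosed := Submodule.isClosed_topologicalClosure _
  lact_mem a y hy := lact_mem_lsub_of_mem h I a hy
  ract_mem y b hy := by rw [hIJ] at hy ⊢; exact ract_mem_rsub_of_mem h J b hy
  left_full := by
    set W := Submodule.span ℂ {a : A | ∃ x ∈ I.lsub X, ∃ y ∈ I.lsub X, a = linner A x y} with hW
    have hcl : IsClosed (closure (W : Set A)) := isClosed_closure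
    apply Set.Subset.antisymm
    · intro a ha
      refine I.mem_of_mul_mem_left hcl ha fun e he => ?_
      refine I.mem_of_mul_mem hcl (I.mul_mem_right a he) fun f hf => ?_
      refine h.linner_induction (p := fun a => e * a * f ∈ closure (W : Set A))
        (hcl.preimage (by fun_prop)) (fun a b ha hb => ?_) (fun x y => ?_) a
      · rw [mul_add, add_mul]
        exact W.topologicalClosure.add_mem ha hb
      · refine subset_closure (Submodule.subset_span ⟨e ⊳ x, lact_mem_lsub I ⟨e, he⟩ x,
          star f ⊳ y, lact_mem_lsub I ⟨_, star_mem hf⟩ y, ?_⟩)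
        rw [h.lact_linner, h.linner_lact_right, star_star, mul_assoc]
    · refine closure_minimal (fun a ha => ?_) I.isClosed
      induction ha using Submodule.span_induction with
      | mem a ha =>
        obtain ⟨x, hx, y, hy, rfl⟩ := ha
        exact linner_mem_of_left h I hx y
      | zero => exact zero_mem I
      | add a b _ _ ha hb => exact add_mem (S := ClosedIdeal A) ha hb
      | smul c a _ ha => exact I.smul_mem' c ha
  right_full := by
    rw [hIJ]
    set W := Submodule.span ℂ {b : B | ∃ x ∈ J.rsub X, ∃ y ∈ J.rsub X, b = rinner B x y} with hW
    have hcl : IsClosed (closure (W : Set B)) := isClosed_closure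
    apply Set.Subset.antisymm
    · intro b hb
      refine J.mem_of_mul_mem_left hcl hb fun e he => ?_
      refine J.mem_of_mul_mem hcl (J.mul_mem_right b he) fun f hf => ?_
      refine h.rinner_induction (p := fun b => e * b * f ∈ closure (W : Set B))
        (hcl.preimage (by fun_prop)) (fun a b ha hb => ?_) (fun x y => ?_) b
      · rw [mul_add, add_mul]
        exact W.topologicalClosure.add_mem ha hb
      · refine subset_closure (Submodule.subset_span ⟨x ⊲ star e,
          ract_mem_rsub J ⟨_, star_mem he⟩ x, y ⊲ f, ract_mem_rsub J ⟨_, hf⟩ y, ?_⟩)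
        rw [h.rinner_ract, h.ract_rinner, star_star]
    · refine closure_minimal (fun b hb => ?_) J.isClosed
      induction hb using Submodule.span_induction with
      | mem a ha =>
        obtain ⟨x, hx, y, hy, rfl⟩ := ha
        exact rinner_mem_of_left h J hx y
      | zero => exact zero_mem J
      | add a b _ _ ha hb => exact add_mem (S := ClosedIdeal B) ha hb
      | smul c a _ ha => exact J.smul_mem' c ha

end ClosedIdeal

/-! ### Multipliers -/

namespace DoubleCentralizer

variable {D : Type*} [NonUnitalCStarAlgebra D]

lemma eq_of_mul_left {a b : D} (hab : ∀ c, c * a = c * b) : a = b := by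
  rw [← sub_eq_zero, ← CStarRing.star_mul_self_eq_zero_iff, mul_sub, hab, sub_self]

lemma eq_of_mul_right {a b : D} (hab : ∀ c, a * c = b * c) : a = b := by
  rw [← sub_eq_zero, ← CStarRing.mul_star_self_eq_zero_iff, sub_mul, hab, sub_self]

lemma ext_fst {m n : DoubleCentralizer ℂ D} (hmn : ∀ x, m.fst x = n.fst x) : m = n := by
  refine DoubleCentralizer.ext _ _ _ _ (Prod.ext (ContinuousLinearMap.ext hmn)
    (ContinuousLinearMap.ext fun x => eq_of_mul_right fun c => ?_))
  rw [m.central, n.central, hmn]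

/-- In a C⋆-algebra, a pair of maps with `R x * y = x * L y` is a multiplier: the identity forces
both maps to be linear, and continuous by the closed graph theorem. -/
noncomputable def ofCentral (L R : D → D) (hLR : ∀ x y, R x * y = x * L y) :
    DoubleCentralizer ℂ D where
  fst := ContinuousLinearMap.ofSeqClosedGraph
    (g := ⟨⟨L, fun x y => eq_of_mul_left fun c => by
        rw [← hLR, mul_add, mul_add, hLR, hLR]⟩, fun k x => eq_of_mul_left fun c => by
        simp [← hLR, mul_smul_comm]⟩)
    (fun u x y hx hy => eq_of_mul_left fun c => by
      change _ = c * L x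
      rw [← hLR]
      refine tendsto_nhds_unique (hy.const_mul c) ?_
      refine (hx.const_mul (R c)).congr fun n => ?_
      exact hLR _ _)
  snd := ContinuousLinearMap.ofSeqClosedGraph
    (g := ⟨⟨R, fun x y => eq_of_mul_right fun c => by
        rw [hLR, add_mul, add_mul, hLR, hLR]⟩, fun k x => eq_of_mul_right fun c => by
        simp [hLR, smul_mul_assoc]⟩)
    (fun u x y hx hy => eq_of_mul_right fun c => by
      change _ = R x * c
      rw [hLR]
      refine tendsto_nhds_unique (hy.mul_const c) ?_
      refine (hx.mul_const (L c)).congr fun n => ?_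
      exact (hLR _ _).symm)
  central := hLR

end DoubleCentralizer

namespace ClosedIdeal

open DoubleCentralizer

section Ideal

variable {A : Type*} [NonUnitalCStarAlgebra A]

/-- A multiplier of `J` maps `I ∩ J` into `I`: if `e` runs through an approximate unit of `I ∩ J`,
then `a m` is the limit of `(e a) m = e (a m) ∈ I`. -/
lemma snd_mem (I J : ClosedIdeal A) (m : J.Mult) (a : J) (ha : (a : A) ∈ I) :
    (m.snd a : A) ∈ I := by
  obtain ⟨l, hl, -⟩ := exists_approximateUnit (I ⊓ J : ClosedIdeal A)
  have := hl.neBot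
  have h1 : Filter.Tendsto (fun e : (I ⊓ J : ClosedIdeal A) => (⟨e, e.2.2⟩ * a : J)) l
      (nhds a) :=
    tendsto_subtype_rng.2 ((continuous_subtype_val.tendsto
      (⟨a, ha, a.2⟩ : (I ⊓ J : ClosedIdeal A))).comp (hl.tendsto_mul_right _))
  refine I.isClosed.mem_of_tendsto
    (((continuous_subtype_val.comp m.snd.continuous).tendsto a).comp h1) (.of_forall fun e => ?_)
  simp only [Function.comp_apply, mult_snd_mul]
  exact I.mul_mem_right _ e.2.1

lemma fst_snd_comm (I : ClosedIdeal A) (m n : I.Mult) (a : I) :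
    m.fst (n.snd a) = n.snd (m.fst a) :=
  eq_of_mul_left fun c => by
    rw [← m.central, ← mult_snd_mul, ← mult_snd_mul, m.central]

end Ideal

variable {A B X : Type*} [NonUnitalCStarAlgebra A] [NonUnitalCStarAlgebra B]
  [NormedAddCommGroup X] [NormedSpace ℂ X] [LeftInnerData A X] [RightInnerData B X]

lemma linner_lmul_left (h : IsImprimitivityBimodule A B X) (I : ClosedIdeal A) (m : I.Mult) {x : X}
    (hx : x ∈ I.lsub X) (z : X) :
    linner A (I.lmul m x) z = m.fst ⟨linner A x z, linner_mem_of_left h I hx z⟩ := by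
  have h1 : (⟨_, linner_mem_of_left h I (lmul_mem h I m hx) z⟩ : I) =
      m.fst ⟨linner A x z, linner_mem_of_left h I hx z⟩ := by
    refine eq_of_mul_left fun c => ?_
    rw [← m.central]
    refine Subtype.ext ?_
    change (c : A) * linner A (I.lmul m x) z = (m.snd c : A) * linner A x z
    rw [← h.lact_linner, lact_lmul h I m hx, h.lact_linner]
  exact congrArg Subtype.val h1

lemma rinner_rmul_right (h : IsImprimitivityBimodule A B X) (J : ClosedIdeal B) (m : J.Mult) {x : X}
    (hx : x ∈ J.rsub X) (z : X) :
    rinner B z (J.rmul x m) = m.snd ⟨rinner B z x, rinner_mem_of_right h J z hx⟩ := by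
  have h1 : (⟨_, rinner_mem_of_right h J z (rmul_mem h J m hx)⟩ : J) =
      m.snd ⟨rinner B z x, rinner_mem_of_right h J z hx⟩ := by
    refine eq_of_mul_right fun c => ?_
    rw [m.central]
    refine Subtype.ext ?_
    change rinner B z (J.rmul x m) * (c : B) = rinner B z x * (m.fst c : B)
    rw [← h.rinner_ract, rmul_ract h J m hx, h.rinner_ract]
  exact congrArg Subtype.val h1

lemma linner_lmul_right (h : IsImprimitivityBimodule A B X) (I : ClosedIdeal A) (m : I.Mult)
    {x : X} (hx : x ∈ I.lsub X) (z : X) :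
    linner A z (I.lmul (star m) x) = m.snd ⟨linner A z x, linner_mem_of_right h I z hx⟩ := by
  rw [← h.star_linner, linner_lmul_left h I _ hx, DoubleCentralizer.star_fst]
  change star (star (m.snd _ : A)) = _
  rw [star_star]
  congr 2
  exact Subtype.ext (h.star_linner x z)

lemma rinner_rmul_left (h : IsImprimitivityBimodule A B X) (J : ClosedIdeal B) (m : J.Mult) {x : X}
    (hx : x ∈ J.rsub X) (z : X) :
    rinner B (J.rmul x (star m)) z = m.fst ⟨rinner B x z, rinner_mem_of_left h J hx z⟩ := by
  rw [← h.star_rinner, rinner_rmul_right h J _ hx, DoubleCentralizer.star_snd]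
  change star (star (m.fst _ : B)) = _
  rw [star_star]
  congr 2
  exact Subtype.ext (h.star_rinner z x)

lemma linner_rmul (h : IsImprimitivityBimodule A B X) (J : ClosedIdeal B) (m : J.Mult) {x y : X}
    (hx : x ∈ J.rsub X) (hy : y ∈ J.rsub X) :
    linner A (J.rmul x m) y = linner A x (J.rmul y (star m)) := by
  rw [← sub_eq_zero]
  refine h.eq_zero_of_lact fun z => ?_
  rw [h.sub_lact, h.linner_lact, h.linner_lact, rinner_rmul_left h J m hy, ← rmul_ract h J m hx,
    sub_self]

lemma rinner_lmul (h : IsImprimitivityBimodule A B X) (I : ClosedIdeal A) (m : I.Mult) {x y : X}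
    (hx : x ∈ I.lsub X) (hy : y ∈ I.lsub X) :
    rinner B (I.lmul (star m) x) y = rinner B x (I.lmul m y) := by
  rw [← sub_eq_zero]
  refine h.eq_zero_of_ract fun z => ?_
  rw [h.ract_sub, ← h.linner_lact, ← h.linner_lact, linner_lmul_right h I m hx,
    ← lact_lmul h I m hy, sub_self]

lemma lmul_mul (h : IsImprimitivityBimodule A B X) (I : ClosedIdeal A) (m n : I.Mult) {x : X}
    (hx : x ∈ I.lsub X) : I.lmul (m * n) x = I.lmul m (I.lmul n x) := by
  have hn := lmul_mem h I n hx
  refine (lmul_unique h I _ hx (lmul_mem h I m hn) fun c => ?_).symm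
  rw [lact_lmul h I m hn, lact_lmul h I n hx]
  rfl

lemma rmul_mul (h : IsImprimitivityBimodule A B X) (J : ClosedIdeal B) (m n : J.Mult) {x : X}
    (hx : x ∈ J.rsub X) : J.rmul x (m * n) = J.rmul (J.rmul x m) n := by
  have hm := rmul_mem h J m hx
  refine (rmul_unique h J _ hx (rmul_mem h J n hm) fun c => ?_).symm
  rw [rmul_ract h J n hm, rmul_ract h J m hx]
  rfl

lemma lmul_one (h : IsImprimitivityBimodule A B X) (I : ClosedIdeal A) {x : X}
    (hx : x ∈ I.lsub X) : I.lmul 1 x = x :=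
  (lmul_unique h I 1 hx hx fun _ => rfl).symm

lemma rmul_one (h : IsImprimitivityBimodule A B X) (J : ClosedIdeal B) {x : X}
    (hx : x ∈ J.rsub X) : J.rmul x 1 = x :=
  (rmul_unique h J 1 hx hx fun _ => rfl).symm

lemma rmul_mem_lsub (h : IsImprimitivityBimodule A B X) {I : ClosedIdeal A}
    {J : ClosedIdeal B} (hIJ : I.lsub X = J.rsub X) (n : J.Mult)
    {x : X} (hx : x ∈ I.lsub X) : J.rmul x n ∈ I.lsub X := by
  rw [hIJ] at hx ⊢; exact rmul_mem h J n hx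

lemma lact_rmul (h : IsImprimitivityBimodule A B X) {I : ClosedIdeal A} {J : ClosedIdeal B}
    (hIJ : I.lsub X = J.rsub X) (m : J.Mult) (a : A) {x : X} (hx : x ∈ J.rsub X) :
    a ⊳ J.rmul x m = J.rmul (a ⊳ x) m := by
  have hmem : ∀ {z : X}, z ∈ J.rsub X → a ⊳ z ∈ J.rsub X := fun hz => by
    rw [← hIJ] at hz ⊢; exact lact_mem_lsub_of_mem h I a hz
  refine rmul_unique h J m (hmem hx) (hmem (rmul_mem h J m hx)) fun c => ?_
  rw [← h.lact_ract, rmul_ract h J m hx, h.lact_ract]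

lemma lmul_rmul (h : IsImprimitivityBimodule A B X) {I : ClosedIdeal A} {J : ClosedIdeal B}
    (hIJ : I.lsub X = J.rsub X) (m : I.Mult) (n : J.Mult) {x : X} (hx : x ∈ I.lsub X) :
    I.lmul m (J.rmul x n) = J.rmul (I.lmul m x) n := by
  have hm := lmul_mem h I m hx
  refine (lmul_unique h I m (rmul_mem_lsub h hIJ n hx)
    (rmul_mem_lsub h hIJ n hm) fun c => ?_).symm
  rw [lact_rmul h hIJ n c (hIJ ▸ hm), lact_rmul h hIJ n _ (hIJ ▸ hx), lact_lmul h I m hx]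

end ClosedIdeal

/-! ### Ideals of the linking algebra -/

namespace Linking

variable {A B X : Type*} [NonUnitalCStarAlgebra A] [NonUnitalCStarAlgebra B]
  [NormedAddCommGroup X] [NormedSpace ℂ X] [LeftInnerData A X] [RightInnerData B X]
  [h : IsImprimitivityBimodule A B X]

lemma continuous_a : Continuous (Linking.a : Linking A B X → A) :=
  continuous_of_linear_of_bound (𝕜 := ℂ) (C := 1) add_a (fun c m => smul_a m c)
    fun m => (norm_a_le m).trans (one_mul _).ge

lemma continuous_x : Continuous (Linking.x : Linking A B X → X) :=
  continuous_of_linear_of_bound (𝕜 := ℂ) (C := 1) add_x (fun c m => smul_x m c)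
    fun m => (norm_x_le m).trans (one_mul _).ge

lemma continuous_y : Continuous (Linking.y : Linking A B X → X) :=
  AddMonoidHomClass.continuous_of_bound (AddMonoidHom.mk' _ add_y) 1
    fun m => (norm_y_le m).trans (one_mul _).ge

lemma continuous_b : Continuous (Linking.b : Linking A B X → B) :=
  continuous_of_linear_of_bound (𝕜 := ℂ) (C := 1) add_b (fun c m => smul_b m c)
    fun m => (norm_b_le m).trans (one_mul _).ge

lemma continuous_mk : Continuous fun p : A × X × X × B =>
    (⟨p.1, p.2.1, p.2.2.1, p.2.2.2⟩ : Linking A B X) := by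
  refine AddMonoidHomClass.continuous_of_bound
    (AddMonoidHom.mk' (fun p : A × X × X × B =>
      (⟨p.1, p.2.1, p.2.2.1, p.2.2.2⟩ : Linking A B X)) fun _ _ => rfl) 4 fun p => ?_
  have h1 := norm_rep_le (⟨p.1, p.2.1, p.2.2.1, p.2.2.2⟩ : Linking A B X)
  have h2 := norm_fst_le p
  have h3 := (norm_fst_le p.2).trans (norm_snd_le p)
  have h4 := (norm_fst_le p.2.2).trans ((norm_snd_le p.2).trans (norm_snd_le p))
  have h5 := (norm_snd_le p.2.2).trans ((norm_snd_le p.2).trans (norm_snd_le p))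
  change ‖rep A B X _‖ ≤ _
  exact h1.trans (by linarith)

end Linking

namespace ClosedIdeal

open DoubleCentralizer

variable {A B X : Type*} [NonUnitalCStarAlgebra A] [NonUnitalCStarAlgebra B]
  [NormedAddCommGroup X] [NormedSpace ℂ X] [LeftInnerData A X] [RightInnerData B X]
  [h : IsImprimitivityBimodule A B X]

/-- The ideal of the linking algebra which consists of the matrices with diagonal entries in `I`
and `J` and off-diagonal entries in `I · X = X · J`. -/
def linking (I : ClosedIdeal A) (J : ClosedIdeal B) (hIJ : I.lsub X = J.rsub X) :
    ClosedIdeal (Linking A B X) where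
  carrier := {c | c.a ∈ I ∧ c.x ∈ I.lsub X ∧ c.y ∈ I.lsub X ∧ c.b ∈ J}
  zero_mem' := ⟨zero_mem _, zero_mem _, zero_mem _, zero_mem _⟩
  add_mem' hc hd := ⟨add_mem hc.1 hd.1, add_mem hc.2.1 hd.2.1, add_mem hc.2.2.1 hd.2.2.1,
    add_mem hc.2.2.2 hd.2.2.2⟩
  smul_mem' k _ hc := ⟨I.smul_mem' k hc.1, Submodule.smul_mem _ _ hc.2.1,
    Submodule.smul_mem _ _ hc.2.2.1, J.smul_mem' k hc.2.2.2⟩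
  star_mem' hc := ⟨star_mem hc.1, hc.2.2.1, hc.2.1, star_mem hc.2.2.2⟩
  mul_mem_left' c d hd := by
    obtain ⟨ha, hx, hy, hb⟩ := hd
    refine ⟨add_mem (I.mul_mem_left _ ha) (linner_mem_of_right h I _ hy),
      add_mem (lact_mem_lsub_of_mem h I _ hx) ?_,
      add_mem (lact_mem_lsub I ⟨_, star_mem ha⟩ _) ?_,
      add_mem (rinner_mem_of_right h J _ (hIJ ▸ hx)) (J.mul_mem_left _ hb)⟩
    · rw [hIJ]; exact ract_mem_rsub J ⟨_, hb⟩ _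
    · rw [hIJ] at hy ⊢; exact ract_mem_rsub_of_mem h J _ hy
  mul_mem_right' {c} d hc := by
    obtain ⟨ha, hx, hy, hb⟩ := hc
    refine ⟨add_mem (I.mul_mem_right _ ha) (linner_mem_of_left h I hx _),
      add_mem (lact_mem_lsub I ⟨_, ha⟩ _) ?_,
      add_mem (lact_mem_lsub_of_mem h I _ hy) ?_,
      add_mem (rinner_mem_of_left h J (hIJ ▸ hy) _) (J.mul_mem_right _ hb)⟩
    · rw [hIJ] at hx ⊢; exact ract_mem_rsub_of_mem h J _ hx
    · rw [hIJ]; exact ract_mem_rsub J ⟨_, star_mem hb⟩ _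
  isClosed' := (I.isClosed.preimage Linking.continuous_a).inter
    ((I.isClosed_lsub.preimage Linking.continuous_x).inter
      ((I.isClosed_lsub.preimage Linking.continuous_y).inter
        (J.isClosed.preimage Linking.continuous_b)))

variable {I : ClosedIdeal A} {J : ClosedIdeal B}

/-- The multiplier of `linking I J hIJ` given by multiplication with the diagonal matrix with
entries `m` and `n`. -/
noncomputable def linkingMult (hIJ : I.lsub X = J.rsub X) (m : I.Mult) (n : J.Mult) :
    (linking I J hIJ).Mult :=
  ofCentral
    (fun c => ⟨⟨m.fst ⟨c.1.a, c.2.1⟩, I.lmul m c.1.x, J.rmul c.1.y (star n),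
        n.fst ⟨c.1.b, c.2.2.2.2⟩⟩,
      (m.fst _).2, lmul_mem h I m c.2.2.1, rmul_mem_lsub h hIJ _ c.2.2.2.1, (n.fst _).2⟩)
    (fun c => ⟨⟨m.snd ⟨c.1.a, c.2.1⟩, J.rmul c.1.x n, I.lmul (star m) c.1.y,
        n.snd ⟨c.1.b, c.2.2.2.2⟩⟩,
      (m.snd _).2, rmul_mem_lsub h hIJ _ c.2.2.1, lmul_mem h I _ c.2.2.2.1, (n.snd _).2⟩)
    (fun ⟨⟨a, x, y, b⟩, ha, hx, hy, hb⟩ ⟨⟨a', x', y', b'⟩, ha', hx', hy', hb'⟩ => by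
      dsimp only at ha hx hy hb ha' hx' hy' hb'
      refine Subtype.ext (Linking.ext ?_ ?_ ?_ ?_)
      · exact congrArg₂ (· + ·) (congrArg Subtype.val (m.central ⟨a, ha⟩ ⟨a', ha'⟩))
          (linner_rmul h J n (hIJ ▸ hx) (hIJ ▸ hy'))
      · exact congrArg₂ (· + ·) (lact_lmul h I m hx' ⟨a, ha⟩).symm
          (rmul_ract h J n (hIJ ▸ hx) ⟨b', hb'⟩)
      · have h1 := lact_lmul h I (star m) hy (star ⟨a', ha'⟩)
        have h2 := rmul_ract h J (star n) (hIJ ▸ hy') (star ⟨b, hb⟩)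
        rw [DoubleCentralizer.star_snd, star_star] at h1
        rw [DoubleCentralizer.star_fst, star_star] at h2
        exact congrArg₂ (· + ·) h1 h2.symm
      · exact congrArg₂ (· + ·) (rinner_lmul h I m hy hx')
          (congrArg Subtype.val (n.central ⟨b, hb⟩ ⟨b', hb'⟩)))

lemma linkingMult_mul (hIJ : I.lsub X = J.rsub X) (m m' : I.Mult) (n n' : J.Mult) :
    linkingMult hIJ (m * m') (n * n') = linkingMult hIJ m n * linkingMult hIJ m' n' :=
  ext_fst fun c => Subtype.ext <| Linking.ext rfl (lmul_mul h I m m' c.2.2.1)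
    ((congrArg (J.rmul c.1.y) (star_mul n n')).trans
      (rmul_mul h J _ _ (hIJ ▸ c.2.2.2.1))) rfl

lemma linkingMult_one (hIJ : I.lsub X = J.rsub X) :
    linkingMult hIJ (1 : I.Mult) (1 : J.Mult) = 1 :=
  ext_fst fun c => Subtype.ext <| Linking.ext rfl (lmul_one h I c.2.2.1)
    ((congrArg (J.rmul c.1.y) (star_one J.Mult)).trans (rmul_one h J (hIJ ▸ c.2.2.2.1))) rfl

lemma linkingMult_star (hIJ : I.lsub X = J.rsub X) (m : I.Mult) (n : J.Mult) :
    linkingMult hIJ (star m) (star n) = star (linkingMult hIJ m n) :=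
  ext_fst fun c => by
    rw [DoubleCentralizer.star_fst]
    exact Subtype.ext <| Linking.ext (congrArg Subtype.val (DoubleCentralizer.star_fst m _)) rfl
      (congrArg (J.rmul c.1.y) (star_star n))
      (congrArg Subtype.val (DoubleCentralizer.star_fst n _))

/-- The unitary multiplier with diagonal entries `u` and `v`. -/
noncomputable def linkingUnitary (hIJ : I.lsub X = J.rsub X) (u : unitary I.Mult)
    (v : unitary J.Mult) : unitary (linking I J hIJ).Mult :=
  ⟨linkingMult hIJ u v, by
    have hu := Unitary.mem_iff.1 u.2
    have hv := Unitary.mem_iff.1 v.2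
    rw [Unitary.mem_iff, ← linkingMult_star, ← linkingMult_mul, ← linkingMult_mul, hu.1, hu.2,
      hv.1, hv.2, linkingMult_one]
    exact ⟨rfl, rfl⟩⟩

end ClosedIdeal

/-! ### Partial automorphisms and the linking algebra -/

namespace IsPartialAutomorphism

open ClosedIdeal

variable {A B X : Type*} [NonUnitalCStarAlgebra A] [NonUnitalCStarAlgebra B]
  [NormedAddCommGroup X] [NormedSpace ℂ X] [LeftInnerData A X] [RightInnerData B X]
  {I₁ I₂ : ClosedIdeal A} {J₁ J₂ : ClosedIdeal B} {φA : I₁ ≃⋆ₐ[ℂ] I₂}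
  {φ : I₁.lsub X → I₂.lsub X} {φB : J₁ ≃⋆ₐ[ℂ] J₂}

/-- Two elements of `I₂ · X` agree if they have the same inner products with the values of `φ`. -/
lemma eq_of_linner (P : IsPartialAutomorphism φA φ φB) (h : IsImprimitivityBimodule A B X)
    {x y : X} (hx : x ∈ I₂.lsub X) (hy : y ∈ I₂.lsub X)
    (hxy : ∀ z, linner A x (φ z : X) = linner A y (φ z : X)) : x = y :=
  eq_of_linner_left h I₂ hx hy fun z hz => by
    obtain ⟨w, hw⟩ := P.surjective ⟨z, hz⟩
    rw [← h.star_linner, ← h.star_linner y, ← show (φ w : X) = z from congrArg _ hw, hxy]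

lemma map_add (P : IsPartialAutomorphism φA φ φB) (h : IsImprimitivityBimodule A B X)
    (x y : I₁.lsub X) : φ (x + y) = φ x + φ y := by
  refine Subtype.ext (P.eq_of_linner h (φ _).2 (φ x + φ y).2 fun z => ?_)
  have h1 := fun w : I₁.lsub X => linner_mem_of_left h I₁ w.2 (z : X)
  change _ = linner A ((φ x : X) + (φ y : X)) _
  rw [h.add_linner, ← P.map_linner _ _ (h1 _), ← P.map_linner _ _ (h1 _), ← P.map_linner _ _ (h1 _)]
  change _ = ((φA _ + φA _ : I₂) : A)
  rw [← _root_.map_add]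
  exact congrArg (fun a => (φA a : A)) (Subtype.ext (h.add_linner x y z))

lemma map_smul (P : IsPartialAutomorphism φA φ φB) (h : IsImprimitivityBimodule A B X)
    (c : ℂ) (x : I₁.lsub X) : φ (c • x) = c • φ x := by
  refine Subtype.ext (P.eq_of_linner h (φ _).2 (c • φ x).2 fun z => ?_)
  have h1 := fun w : I₁.lsub X => linner_mem_of_left h I₁ w.2 (z : X)
  change _ = linner A (c • (φ x : X)) _
  rw [h.smul_linner, ← P.map_linner _ _ (h1 _), ← P.map_linner _ _ (h1 _)]
  change _ = ((c • φA _ : I₂) : A)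
  rw [← _root_.map_smul]
  exact congrArg (fun a => (φA a : A)) (Subtype.ext (h.smul_linner c x z))

lemma map_zero (P : IsPartialAutomorphism φA φ φB) (h : IsImprimitivityBimodule A B X) :
    φ 0 = 0 := by
  simpa using P.map_smul h 0 0

lemma injective (P : IsPartialAutomorphism φA φ φB) (h : IsImprimitivityBimodule A B X) :
    Function.Injective φ := fun x y hxy => by
  have h1 := fun w : I₁.lsub X => linner_mem_of_left h I₁ w.2
  refine Subtype.ext (eq_of_linner_left h I₁ x.2 y.2 fun z hz => ?_)
  have h2 : φA ⟨linner A z (x : X), h1 ⟨z, hz⟩ x⟩ = φA ⟨linner A z (y : X), h1 ⟨z, hz⟩ y⟩ :=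
    Subtype.ext <| by rw [P.map_linner ⟨z, hz⟩ x, P.map_linner ⟨z, hz⟩ y, hxy]
  exact congrArg Subtype.val (φA.injective h2)

variable [h : IsImprimitivityBimodule A B X] {h₁ : I₁.lsub X = J₁.rsub X}
  {h₂ : I₂.lsub X = J₂.rsub X}

variable (h₁ h₂) in
/-- A partial automorphism of `X`, applied entrywise, is an isomorphism between ideals of the
linking algebra. -/
noncomputable def linkingEquiv (P : IsPartialAutomorphism φA φ φB) :
    linking I₁ J₁ h₁ ≃⋆ₐ[ℂ] linking I₂ J₂ h₂ where
  toFun c := ⟨⟨φA ⟨c.1.a, c.2.1⟩, φ ⟨c.1.x, c.2.2.1⟩, φ ⟨c.1.y, c.2.2.2.1⟩,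
    φB ⟨c.1.b, c.2.2.2.2⟩⟩, (φA _).2, (φ _).2, (φ _).2, (φB _).2⟩
  invFun c :=
    let ψ := (Equiv.ofBijective φ ⟨P.injective h, P.surjective⟩).symm
    ⟨⟨φA.symm ⟨c.1.a, c.2.1⟩, ψ ⟨c.1.x, c.2.2.1⟩, ψ ⟨c.1.y, c.2.2.2.1⟩,
      φB.symm ⟨c.1.b, c.2.2.2.2⟩⟩, (φA.symm _).2, (ψ _).2, (ψ _).2, (φB.symm _).2⟩
  left_inv c := by
    refine Subtype.ext (Linking.ext ?_ ?_ ?_ ?_)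
    · exact congrArg Subtype.val (φA.symm_apply_apply _)
    · exact congrArg Subtype.val (Equiv.ofBijective_symm_apply_apply φ _ _)
    · exact congrArg Subtype.val (Equiv.ofBijective_symm_apply_apply φ _ _)
    · exact congrArg Subtype.val (φB.symm_apply_apply _)
  right_inv c := by
    refine Subtype.ext (Linking.ext ?_ ?_ ?_ ?_)
    · exact congrArg Subtype.val (φA.apply_symm_apply _)
    · exact congrArg Subtype.val (Equiv.ofBijective_apply_symm_apply φ ⟨P.injective h, P.surjective⟩ _)
    · exact congrArg Subtype.val (Equiv.ofBijective_apply_symm_apply φ ⟨P.injective h, P.surjective⟩ _)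
    · exact congrArg Subtype.val (φB.apply_symm_apply _)
  map_add' c d := Subtype.ext <| Linking.ext
    (congrArg Subtype.val (_root_.map_add φA ⟨c.1.a, c.2.1⟩ ⟨d.1.a, d.2.1⟩))
    (congrArg Subtype.val (P.map_add h ⟨c.1.x, c.2.2.1⟩ ⟨d.1.x, d.2.2.1⟩))
    (congrArg Subtype.val (P.map_add h ⟨c.1.y, c.2.2.2.1⟩ ⟨d.1.y, d.2.2.2.1⟩))
    (congrArg Subtype.val (_root_.map_add φB ⟨c.1.b, c.2.2.2.2⟩ ⟨d.1.b, d.2.2.2.2⟩))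
  map_smul' k c := Subtype.ext <| Linking.ext
    (congrArg Subtype.val (_root_.map_smul φA k ⟨c.1.a, c.2.1⟩))
    (congrArg Subtype.val (P.map_smul h k ⟨c.1.x, c.2.2.1⟩))
    (congrArg Subtype.val (P.map_smul h (star k) ⟨c.1.y, c.2.2.2.1⟩))
    (congrArg Subtype.val (_root_.map_smul φB k ⟨c.1.b, c.2.2.2.2⟩))
  map_star' c := Subtype.ext <| Linking.ext
    (congrArg Subtype.val (map_star φA ⟨c.1.a, c.2.1⟩)) rfl rfl
    (congrArg Subtype.val (map_star φB ⟨c.1.b, c.2.2.2.2⟩))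
  map_mul' := fun ⟨⟨a, x, y, b⟩, ha, hx, hy, hb⟩ ⟨⟨a', x', y', b'⟩, ha', hx', hy', hb'⟩ => by
    dsimp only at ha hx hy hb ha' hx' hy' hb'
    -- An off-diagonal entry of a product is a sum of a left and a right multiple, and `φ` respects
    -- both.
    have key : ∀ (d : I₁) (z w : I₁.lsub X) (e : J₁) (hs : (d : A) ⊳ (z : X) + (w : X) ⊲ (e : B) ∈
        I₁.lsub X), (φ ⟨(d : A) ⊳ (z : X) + (w : X) ⊲ (e : B), hs⟩ : X) =
          (φA d : A) ⊳ (φ z : X) + (φ w : X) ⊲ (φB e : B) := by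
      intro d z w e hs
      have hd : (d : A) ⊳ (z : X) ∈ I₁.lsub X := lact_mem_lsub I₁ d (z : X)
      have he : (w : X) ⊲ (e : B) ∈ I₁.lsub X := h₁.ge (ract_mem_rsub J₁ e (w : X))
      rw [← P.map_lact d z hd, ← P.map_ract w e he]
      exact congrArg Subtype.val (P.map_add h ⟨_, hd⟩ ⟨_, he⟩)
    refine Subtype.ext (Linking.ext ?_ ?_ ?_ ?_)
    · have hl := linner_mem_of_left h I₁ hx y'
      refine (congrArg Subtype.val (_root_.map_add φA (⟨a, ha⟩ * ⟨a', ha'⟩) ⟨_, hl⟩)).trans ?_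
      exact congrArg₂ (· + ·) (congrArg Subtype.val (_root_.map_mul φA ⟨a, ha⟩ ⟨a', ha'⟩))
        (P.map_linner ⟨x, hx⟩ ⟨y', hy'⟩ hl)
    · exact key ⟨a, ha⟩ ⟨x', hx'⟩ ⟨x, hx⟩ ⟨b', hb'⟩ _
    · refine (key (star ⟨a', ha'⟩) ⟨y, hy⟩ ⟨y', hy'⟩ (star ⟨b, hb⟩) _).trans ?_
      rw [map_star, map_star]
      rfl
    · have hr := rinner_mem_of_left h J₁ (x := y) (h₁ ▸ hy) x'
      refine (congrArg Subtype.val (_root_.map_add φB ⟨_, hr⟩ (⟨b, hb⟩ * ⟨b', hb'⟩))).trans ?_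
      exact congrArg₂ (· + ·) (P.map_rinner ⟨y, hy⟩ ⟨x', hx'⟩ hr)
        (congrArg Subtype.val (_root_.map_mul φB ⟨b, hb⟩ ⟨b', hb'⟩))

end IsPartialAutomorphism

/-! ### The twisted action on the linking algebra -/

/-- If `a ∈ A_{r^*} ∩ A_{st}`, then `α_r(a) ∈ A_{rs}`; this is part of the cocycle identity. -/
lemma TwistedAction.map_mem {S A : Type*} [InverseMonoid S] [NonUnitalCStarAlgebra A]
    (𝒜 : TwistedAction S A) (r s t : S) {a : A} (h₁ : a ∈ 𝒜.ideal r⁻¹)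
    (h₂ : a ∈ 𝒜.ideal (s * t)) : (𝒜.map r ⟨a, h₁⟩ : A) ∈ 𝒜.ideal (r * s) :=
  let ⟨_, _, h₃, _⟩ := 𝒜.cocycle r s t a h₁ h₂
  h₃

namespace TwistedMoritaEquivalence

open ClosedIdeal

variable {S A B X : Type*} [InverseMonoid S] [NonUnitalCStarAlgebra A] [NonUnitalCStarAlgebra B]
  [NormedAddCommGroup X] [NormedSpace ℂ X] [LeftInnerData A X] [RightInnerData B X]
  {𝒜 : TwistedAction S A} {ℬ : TwistedAction S B}

lemma φ_mem (M : TwistedMoritaEquivalence X 𝒜 ℬ) (r s t : S) {x : X}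
    (h₁ : x ∈ (𝒜.ideal r⁻¹).lsub X) (h₂ : x ∈ (𝒜.ideal (s * t)).lsub X) :
    (M.φ r ⟨x, h₁⟩ : X) ∈ (𝒜.ideal (r * s)).lsub X := by
  have h := M.imprimitivity
  rw [mem_lsub_iff h] at h₂ ⊢
  rw [← (M.isPartialAutomorphism r).map_linner _ _ (linner_mem_of_left h _ h₁ x)]
  exact 𝒜.map_mem r s t _ h₂

/-- The cocycle identity on the upper right corner of the linking algebra. The inner products of
both sides with `φ_r(z)` are the two sides of the cocycle identity of `ℬ` at `⟨z, x⟩_B`. -/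
lemma φ_cocycle_right (M : TwistedMoritaEquivalence X 𝒜 ℬ) (r s t : S) {x : X}
    (h₁ : x ∈ (𝒜.ideal r⁻¹).lsub X) (h₂ : x ∈ (𝒜.ideal (s * t)).lsub X)
    (p₁ : (ℬ.ideal (s * t)).rmul x (ℬ.mult s t).1 ∈ (𝒜.ideal r⁻¹).lsub X)
    (p₂ : (M.φ r ⟨_, p₁⟩ : X) ∈ (𝒜.ideal (r * (s * t))).lsub X)
    (p₃ : (M.φ r ⟨x, h₁⟩ : X) ∈ (𝒜.ideal (r * s)).lsub X)
    (p₄ : (ℬ.ideal (r * s)).rmul (M.φ r ⟨x, h₁⟩ : X) (ℬ.mult r s).1 ∈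
      (𝒜.ideal (r * s * t)).lsub X)
    (q₁ : (ℬ.ideal (r * (s * t))).rmul (M.φ r ⟨_, p₁⟩ : X) (ℬ.mult r (s * t)).1 ∈
      (𝒜.ideal r).lsub X)
    (q₂ : (ℬ.ideal (r * s * t)).rmul ((ℬ.ideal (r * s)).rmul (M.φ r ⟨x, h₁⟩ : X)
      (ℬ.mult r s).1) (ℬ.mult (r * s) t).1 ∈ (𝒜.ideal r).lsub X) :
    (ℬ.ideal (r * (s * t))).rmul (M.φ r ⟨_, p₁⟩ : X) (ℬ.mult r (s * t)).1 =
      (ℬ.ideal (r * s * t)).rmul ((ℬ.ideal (r * s)).rmul (M.φ r ⟨x, h₁⟩ : X)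
        (ℬ.mult r s).1) (ℬ.mult (r * s) t).1 := by
  have h := M.imprimitivity
  have P := M.isPartialAutomorphism r
  have hsub := fun k : S => (M.sub_eq k).le
  refine eq_of_rinner_left h _ q₁ q₂ fun w hw => ?_
  obtain ⟨z, hz⟩ := P.surjective ⟨w, hw⟩
  obtain rfl : (M.φ r z : X) = w := congrArg Subtype.val hz
  have k₁ := rinner_mem_of_right h (ℬ.ideal r⁻¹) (z : X) (hsub _ h₁)
  have k₂ := rinner_mem_of_right h (ℬ.ideal (s * t)) (z : X) (hsub _ h₂)
  obtain ⟨e₁, e₂, e₃, e₄, he⟩ := ℬ.cocycle r s t (rinner B (z : X) x) k₁ k₂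
  rw [rinner_rmul_right h _ _ (hsub _ p₂), rinner_rmul_right h _ _ (hsub _ p₄)]
  refine Eq.trans ?_ (he.trans ?_)
  · refine congrArg (fun b => ((ℬ.mult r (s * t)).1.snd b : B)) (Subtype.ext ?_)
    refine (P.map_rinner z ⟨_, p₁⟩ (rinner_mem_of_right h _ _ (hsub _ p₁))).symm.trans ?_
    exact congrArg (fun b => (ℬ.map r b : B))
      (Subtype.ext (rinner_rmul_right h _ _ (hsub _ h₂) _))
  · refine congrArg (fun b => ((ℬ.mult (r * s) t).1.snd b : B)) (Subtype.ext ?_)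
    refine Eq.trans ?_ (rinner_rmul_right h _ _ (hsub _ p₃) _).symm
    exact congrArg (fun b => ((ℬ.mult r s).1.snd b : B)) (Subtype.ext (P.map_rinner z ⟨x, h₁⟩ k₁))

/-- The cocycle identity on the lower left corner of the linking algebra. The inner products of
`φ_r(z)` and both sides are the two sides of the cocycle identity of `𝒜` at `⟨z, y⟩_A`. -/
lemma φ_cocycle_left (M : TwistedMoritaEquivalence X 𝒜 ℬ) (r s t : S) {y : X}
    (h₁ : y ∈ (𝒜.ideal r⁻¹).lsub X) (h₂ : y ∈ (𝒜.ideal (s * t)).lsub X)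
    (p₁ : (𝒜.ideal (s * t)).lmul (star (𝒜.mult s t).1) y ∈ (𝒜.ideal r⁻¹).lsub X)
    (p₂ : (M.φ r ⟨_, p₁⟩ : X) ∈ (𝒜.ideal (r * (s * t))).lsub X)
    (p₃ : (M.φ r ⟨y, h₁⟩ : X) ∈ (𝒜.ideal (r * s)).lsub X)
    (p₄ : (𝒜.ideal (r * s)).lmul (star (𝒜.mult r s).1) (M.φ r ⟨y, h₁⟩ : X) ∈
      (𝒜.ideal (r * s * t)).lsub X)
    (q₁ : (𝒜.ideal (r * (s * t))).lmul (star (𝒜.mult r (s * t)).1) (M.φ r ⟨_, p₁⟩ : X) ∈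
      (𝒜.ideal r).lsub X)
    (q₂ : (𝒜.ideal (r * s * t)).lmul (star (𝒜.mult (r * s) t).1) ((𝒜.ideal (r * s)).lmul
      (star (𝒜.mult r s).1) (M.φ r ⟨y, h₁⟩ : X)) ∈ (𝒜.ideal r).lsub X) :
    (𝒜.ideal (r * (s * t))).lmul (star (𝒜.mult r (s * t)).1) (M.φ r ⟨_, p₁⟩ : X) =
      (𝒜.ideal (r * s * t)).lmul (star (𝒜.mult (r * s) t).1) ((𝒜.ideal (r * s)).lmul
        (star (𝒜.mult r s).1) (M.φ r ⟨y, h₁⟩ : X)) := by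
  have h := M.imprimitivity
  have P := M.isPartialAutomorphism r
  refine eq_of_linner_left h _ q₁ q₂ fun w hw => ?_
  obtain ⟨z, hz⟩ := P.surjective ⟨w, hw⟩
  obtain rfl : (M.φ r z : X) = w := congrArg Subtype.val hz
  have k₁ := linner_mem_of_right h (𝒜.ideal r⁻¹) (z : X) h₁
  have k₂ := linner_mem_of_right h (𝒜.ideal (s * t)) (z : X) h₂
  obtain ⟨e₁, e₂, e₃, e₄, he⟩ := 𝒜.cocycle r s t (linner A (z : X) y) k₁ k₂
  rw [linner_lmul_right h _ _ p₂, linner_lmul_right h _ _ p₄]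
  refine Eq.trans ?_ (he.trans ?_)
  · refine congrArg (fun b => ((𝒜.mult r (s * t)).1.snd b : A)) (Subtype.ext ?_)
    refine (P.map_linner z ⟨_, p₁⟩ (linner_mem_of_right h _ _ p₁)).symm.trans ?_
    exact congrArg (fun b => (𝒜.map r b : A))
      (Subtype.ext (linner_lmul_right h _ _ h₂ _))
  · refine congrArg (fun b => ((𝒜.mult (r * s) t).1.snd b : A)) (Subtype.ext ?_)
    refine Eq.trans ?_ (linner_lmul_right h _ _ p₃ _).symm
    exact congrArg (fun b => ((𝒜.mult r s).1.snd b : A)) (Subtype.ext (P.map_linner z ⟨y, h₁⟩ k₁))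

variable [h : IsImprimitivityBimodule A B X]

/-- The ideal `C_s` of the linking algebra. -/
abbrev linkingIdeal (M : TwistedMoritaEquivalence X 𝒜 ℬ) (s : S) : ClosedIdeal (Linking A B X) :=
  linking (𝒜.ideal s) (ℬ.ideal s) (M.sub_eq s)

/-- The isomorphism `γ_s : C_{s^*} → C_s`. -/
noncomputable abbrev linkingMap (M : TwistedMoritaEquivalence X 𝒜 ℬ) (s : S) :
    M.linkingIdeal s⁻¹ ≃⋆ₐ[ℂ] M.linkingIdeal s :=
  (M.isPartialAutomorphism s).linkingEquiv (M.sub_eq s⁻¹) (M.sub_eq s)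

lemma linkingMap_mem (M : TwistedMoritaEquivalence X 𝒜 ℬ) (r s t : S) {c : Linking A B X}
    (h₁ : c ∈ M.linkingIdeal r⁻¹) (h₂ : c ∈ M.linkingIdeal (s * t)) :
    (M.linkingMap r ⟨c, h₁⟩ : Linking A B X) ∈ M.linkingIdeal (r * s) :=
  ⟨𝒜.map_mem r s t h₁.1 h₂.1, M.φ_mem r s t h₁.2.1 h₂.2.1, M.φ_mem r s t h₁.2.2.1 h₂.2.2.1,
    ℬ.map_mem r s t h₁.2.2.2 h₂.2.2.2⟩

/-- The Busby–Smith twisted action `(C, S, γ, w)` on the linking algebra of a Morita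
equivalence. -/
noncomputable def linkingAction (M : TwistedMoritaEquivalence X 𝒜 ℬ) :
    TwistedAction S (Linking A B X) where
  ideal := M.linkingIdeal
  map := M.linkingMap
  mult s t := linkingUnitary (M.sub_eq (s * t)) (𝒜.mult s t) (ℬ.mult s t)
  ideal_one c := by
    have hx : ∀ x : X, x ∈ (𝒜.ideal 1).lsub X := fun x =>
      (mem_lsub_iff h _).2 (𝒜.ideal_one _)
    exact ⟨𝒜.ideal_one _, hx _, hx _, ℬ.ideal_one _⟩
  dom_comp s t c := by
    constructor
    · rintro ⟨ha, hx, hy, hb⟩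
      obtain ⟨ha₁, ha₂⟩ := (𝒜.dom_comp s t _).1 ha
      obtain ⟨hx₁, hx₂⟩ := (M.dom_comp s t _).1 hx
      obtain ⟨hy₁, hy₂⟩ := (M.dom_comp s t _).1 hy
      obtain ⟨hb₁, hb₂⟩ := (ℬ.dom_comp s t _).1 hb
      exact ⟨⟨ha₁, hx₁, hy₁, hb₁⟩, ha₂, hx₂, hy₂, hb₂⟩
    · rintro ⟨⟨ha₁, hx₁, hy₁, hb₁⟩, ha₂, hx₂, hy₂, hb₂⟩
      exact ⟨(𝒜.dom_comp s t _).2 ⟨ha₁, ha₂⟩, (M.dom_comp s t _).2 ⟨hx₁, hx₂⟩,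
        (M.dom_comp s t _).2 ⟨hy₁, hy₂⟩, (ℬ.dom_comp s t _).2 ⟨hb₁, hb₂⟩⟩
  map_comp s t c hc hc₁ hc₂ := by
    change _ = (((linkingMult _ _ _).fst ((star (linkingMult _ _ _)).snd _) :
      M.linkingIdeal (s * t)) : Linking A B X)
    rw [← linkingMult_star]
    refine Linking.ext ?_ ?_ ?_ ?_
    · exact 𝒜.map_comp s t _ hc.1 hc₁.1 hc₂.1
    · refine (M.φ_comp s t _ hc.2.1 hc₁.2.1 hc₂.2.1).trans ?_
      exact (lmul_rmul h (M.sub_eq (s * t)) _ _ (M.φ (s * t) ⟨c.x, hc.2.1⟩).2).symm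
    · refine (M.φ_comp s t _ hc.2.2.1 hc₁.2.2.1 hc₂.2.2.1).trans ?_
      exact congrArg (fun m => (ℬ.ideal (s * t)).rmul
        ((𝒜.ideal (s * t)).lmul m (M.φ (s * t) ⟨c.y, hc.2.2.1⟩ : X)) _) (star_star _).symm
    · exact ℬ.map_comp s t _ hc.2.2.2 hc₁.2.2.2 hc₂.2.2.2
  mult_idem s t hst := by
    rw [𝒜.mult_idem s t hst, ℬ.mult_idem s t hst]
    exact Subtype.ext (linkingMult_one _)
  cocycle r s t c h₁ h₂ := by
    have p₁ := snd_mem (M.linkingIdeal r⁻¹) _ (linkingMult (M.sub_eq (s * t)) (𝒜.mult s t).1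
      (ℬ.mult s t).1) ⟨c, h₂⟩ h₁
    have p₂ := M.linkingMap_mem r (s * t) 1 p₁ (by rw [mul_one]; exact Subtype.property _)
    have p₃ := M.linkingMap_mem r s t h₁ h₂
    have h₃ := M.linkingMap_mem r (s * t) 1 h₁ (by rwa [mul_one])
    have p₄ := snd_mem (M.linkingIdeal (r * s * t)) _ (linkingMult (M.sub_eq (r * s))
      (𝒜.mult r s).1 (ℬ.mult r s).1) ⟨_, p₃⟩ (by rwa [mul_assoc])
    have q₁ := snd_mem (M.linkingIdeal r) _ (linkingMult (M.sub_eq (r * (s * t)))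
      (𝒜.mult r (s * t)).1 (ℬ.mult r (s * t)).1) ⟨_, p₂⟩ ((M.linkingMap r _).2)
    have q₂ := snd_mem (M.linkingIdeal r) _ (linkingMult (M.sub_eq (r * s * t))
      (𝒜.mult (r * s) t).1 (ℬ.mult (r * s) t).1) ⟨_, p₄⟩
      (snd_mem (M.linkingIdeal r) _ _ _ ((M.linkingMap r _).2))
    refine ⟨p₁, p₂, p₃, p₄, Linking.ext ?_ ?_ ?_ ?_⟩
    · obtain ⟨_, _, _, _, he⟩ := 𝒜.cocycle r s t c.a h₁.1 h₂.1
      exact he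
    · exact M.φ_cocycle_right r s t h₁.2.1 h₂.2.1 p₁.2.1 p₂.2.1 p₃.2.1 p₄.2.1 q₁.2.1 q₂.2.1
    · exact M.φ_cocycle_left r s t h₁.2.2.1 h₂.2.2.1 p₁.2.2.1 p₂.2.2.1 p₃.2.2.1 p₄.2.2.1
        q₁.2.2.1 q₂.2.2.1
    · obtain ⟨_, _, _, _, he⟩ := ℬ.cocycle r s t c.b h₁.2.2.2 h₂.2.2.2
      exact he

end TwistedMoritaEquivalence

/-! ### The corner as an imprimitivity bimodule -/

namespace Linking

open ClosedIdeal

variable {A B X : Type*} [NonUnitalCStarAlgebra A] [NonUnitalCStarAlgebra B]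
  [NormedAddCommGroup X] [NormedSpace ℂ X] [LeftInnerData A X] [RightInnerData B X]
  [h : IsImprimitivityBimodule A B X]

lemma norm_mk_b (b : B) : ‖(⟨0, 0, 0, b⟩ : Linking A B X)‖ = ‖b‖ := by
  refine le_antisymm ?_ (norm_b_le (⟨0, 0, 0, b⟩ : Linking A B X))
  rw [norm_def]
  simpa using norm_rep_le (⟨0, 0, 0, b⟩ : Linking A B X)

section corner

variable (y z : corner A B X)

lemma corner_ext {y z : corner A B X} (hx : y.1.x = z.1.x) (hb : y.1.b = z.1.b) : y = z :=
  Subtype.ext (Linking.ext (y.2.1.trans z.2.1.symm) hx (y.2.2.trans z.2.2.symm) hb)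

@[simp] lemma corner_a : (y : Linking A B X).a = 0 := y.2.1
@[simp] lemma corner_y : (y : Linking A B X).y = 0 := y.2.2

lemma coe_corner_lact (c : Linking A B X) : ((c ⊳ y : corner A B X) : Linking A B X) = c * y := rfl
lemma corner_linner : linner (Linking A B X) y z = y * star (z : Linking A B X) := rfl
@[simp] lemma corner_ract_x (d : B) : (y ⊲ d : corner A B X).1.x = y.1.x ⊲ d := rfl
@[simp] lemma corner_ract_b (d : B) : (y ⊲ d : corner A B X).1.b = y.1.b * d := rfl
lemma corner_rinner : rinner B y z = rinner B y.1.x z.1.x + star y.1.b * z.1.b := rfl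

lemma coe_corner_ract (d : B) :
    ((y ⊲ d : corner A B X) : Linking A B X) = y * ⟨0, 0, 0, d⟩ := by
  ext <;> simp [h.linner_zero, h.lact_zero, h.zero_ract, h.rinner_zero]

lemma star_mul_corner :
    star (y : Linking A B X) * z = ⟨0, 0, 0, rinner B y z⟩ := by
  ext <;> simp [h.zero_linner, h.zero_ract, h.zero_lact, corner_rinner]

end corner

lemma exists_add_eq_star_mul_self {b d : B} (hb : ∃ e, b = star e * e) (hd : ∃ e, d = star e * e) :
    ∃ e, b + d = star e * e := by
  let _ := CStarAlgebra.spectralOrder B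
  let _ := CStarAlgebra.spectralOrderedRing B
  rw [← CStarAlgebra.nonneg_iff_eq_star_mul_self] at *
  exact add_nonneg hb hd

/-- The inner products `⟨y, z⟩ = y z^*` span a dense subspace of the linking algebra: the
products of columns give the entries `⟨x, z⟩_A`, `x · d^*`, `(z · b^*)~` and `b d^*`, and each entry
is a limit of sums of these. -/
lemma corner_left_full : closure (Submodule.span ℂ {c : Linking A B X |
    ∃ y z : corner A B X, c = linner (Linking A B X) y z} : Set (Linking A B X)) = Set.univ := by
  set V := (Submodule.span ℂ {c : Linking A B X |
    ∃ y z : corner A B X, c = linner (Linking A B X) y z}).topologicalClosure with hV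
  have hcl : IsClosed (V : Set (Linking A B X)) := Submodule.isClosed_topologicalClosure _
  have hmem : ∀ y z : corner A B X, (y : Linking A B X) * star (z : Linking A B X) ∈ V :=
    fun y z => Submodule.le_topologicalClosure _ (Submodule.subset_span ⟨y, z, rfl⟩)
  have hprod : ∀ (x z : X) (b d : B),
      (⟨linner A x z, x ⊲ star d, z ⊲ star b, b * star d⟩ : Linking A B X) ∈ V := by
    intro x z b d
    convert hmem ⟨⟨0, x, 0, b⟩, rfl, rfl⟩ ⟨⟨0, z, 0, d⟩, rfl, rfl⟩ using 1
    ext <;> simp [h.lact_zero, h.rinner_zero]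
  have hmk := continuous_mk (A := A) (B := B) (X := X)
  have ha : ∀ a : A, (⟨a, 0, 0, 0⟩ : Linking A B X) ∈ V := fun a =>
    h.linner_induction (p := fun a => (⟨a, 0, 0, 0⟩ : Linking A B X) ∈ V)
      (hcl.preimage (hmk.comp (f := fun a : A => (a, 0, 0, 0)) (by fun_prop)))
      (fun a a' h₁ h₂ => by
        convert add_mem (S := Submodule ℂ (Linking A B X)) h₁ h₂ using 1
        ext <;> simp)
      (fun x z => by simpa [h.ract_zero] using hprod x z 0 0) a
  have hx : ∀ x : X, (⟨0, x, 0, 0⟩ : Linking A B X) ∈ V := fun x =>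
    mem_of_ract_mem h ⊤ (V := {x : X | (⟨0, x, 0, 0⟩ : Linking A B X) ∈ V})
      (hcl.preimage (hmk.comp (f := fun x : X => (0, x, 0, 0)) (by fun_prop)))
      (mem_top _) fun d _ => by
        simpa [h.linner_zero, h.zero_ract] using hprod x 0 0 (star d)
  have hy : ∀ y : X, (⟨0, 0, y, 0⟩ : Linking A B X) ∈ V := fun y =>
    mem_of_ract_mem h ⊤ (V := {y : X | (⟨0, 0, y, 0⟩ : Linking A B X) ∈ V})
      (hcl.preimage (hmk.comp (f := fun y : X => (0, 0, y, 0)) (by fun_prop)))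
      (mem_top _) fun d _ => by
        simpa [h.zero_linner, h.zero_ract] using hprod 0 y (star d) 0
  have hb : ∀ b : B, (⟨0, 0, 0, b⟩ : Linking A B X) ∈ V := fun b =>
    mem_of_mul_mem ⊤ (V := {b : B | (⟨0, 0, 0, b⟩ : Linking A B X) ∈ V})
      (hcl.preimage (hmk.comp (f := fun b : B => (0, 0, 0, b)) (by fun_prop)))
      (mem_top _) fun d _ => by
        simpa [h.zero_linner, h.zero_ract] using hprod 0 0 b (star d)
  refine Set.eq_univ_of_forall fun ⟨a, x, y, b⟩ => ?_
  have h1 : (⟨a, x, y, b⟩ : Linking A B X) =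
      ⟨a, 0, 0, 0⟩ + ⟨0, x, 0, 0⟩ + ⟨0, 0, y, 0⟩ + ⟨0, 0, 0, b⟩ := by ext <;> simp
  rw [h1]
  exact add_mem (add_mem (add_mem (ha a) (hx x)) (hy y)) (hb b)

lemma corner_right_full : closure (Submodule.span ℂ {b : B |
    ∃ y z : corner A B X, b = rinner B y z} : Set B) = Set.univ := by
  refine Set.eq_univ_of_forall fun b => ?_
  refine mem_of_mul_mem ⊤ isClosed_closure (mem_top b) fun d _ => ?_
  refine subset_closure (Submodule.subset_span
    ⟨⟨⟨0, 0, 0, star b⟩, rfl, rfl⟩, ⟨⟨0, 0, 0, d⟩, rfl, rfl⟩, ?_⟩)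
  simp [corner_rinner, h.rinner_zero]

lemma norm_sq_corner_rinner (y : corner A B X) : ‖y‖ ^ 2 = ‖rinner B y y‖ := by
  rw [← norm_mk_b (A := A) (X := X), ← star_mul_corner, CStarRing.norm_star_mul_self, sq]
  rfl

variable (A B X) in
theorem corner_isImprimitivityBimodule :
    IsImprimitivityBimodule (Linking A B X) B (corner A B X) where
  complete := by
    have hcl : IsClosed (corner A B X : Set (Linking A B X)) :=
      (isClosed_eq continuous_a continuous_const).inter
        (isClosed_eq continuous_y continuous_const)
    exact hcl.completeSpace_coe
  lact_add c y z := Subtype.ext (mul_add c y.1 z.1)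
  add_lact c d y := Subtype.ext (add_mul c d y.1)
  lact_smul k c y := Subtype.ext (mul_smul_comm k c y.1)
  smul_lact k c y := Subtype.ext (smul_mul_assoc k c y.1)
  mul_lact c d y := Subtype.ext (mul_assoc c d y.1)
  ract_add y b d := corner_ext (h.ract_add _ _ _) (mul_add _ _ _)
  add_ract y z b := corner_ext (h.add_ract _ _ _) (add_mul _ _ _)
  ract_smul k y b := corner_ext (h.ract_smul _ _ _) (mul_smul_comm _ _ _)
  smul_ract k y b := corner_ext (h.smul_ract _ _ _) (smul_mul_assoc _ _ _)
  ract_mul y b d := corner_ext (h.ract_mul _ _ _) (mul_assoc _ _ _).symm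
  lact_ract c y b := Subtype.ext <| by
    rw [coe_corner_ract, coe_corner_lact, coe_corner_lact, coe_corner_ract, mul_assoc]
  add_linner y z w := add_mul y.1 z.1 (star w.1)
  smul_linner k y z := smul_mul_assoc k y.1 (star z.1)
  lact_linner c y z := mul_assoc c y.1 (star z.1)
  star_linner y z := by simp [corner_linner]
  linner_self_nonneg y := ⟨star y.1, by rw [corner_linner, star_star]⟩
  linner_self_eq_zero y hy := Subtype.ext ((CStarRing.mul_star_self_eq_zero_iff y.1).1 hy)
  norm_sq_linner y := by rw [corner_linner, CStarRing.norm_self_mul_star, sq]; rfl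
  left_full := corner_left_full
  rinner_add y z w := by
    simp only [corner_rinner, Submodule.coe_add, add_x, add_b, h.rinner_add, mul_add]; abel
  rinner_smul k y z := by
    simp [corner_rinner, h.rinner_smul, mul_smul_comm]
  rinner_ract y z b := by
    simp [corner_rinner, h.rinner_ract, add_mul, mul_assoc]
  star_rinner y z := by simp [corner_rinner, h.star_rinner]
  rinner_self_nonneg y := exists_add_eq_star_mul_self (h.rinner_self_nonneg _) ⟨_, rfl⟩
  rinner_self_eq_zero y hy := by
    have h1 := norm_sq_corner_rinner y
    rw [hy, norm_zero, sq_eq_zero_iff, norm_eq_zero] at h1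
    exact h1
  norm_sq_rinner := norm_sq_corner_rinner
  right_full := corner_right_full
  linner_lact y z w := Subtype.ext <| by
    rw [coe_corner_ract, coe_corner_lact, corner_linner, ← star_mul_corner, mul_assoc]

/-- For an ideal `K` of the linking algebra, `K · Y` consists of the columns in `K`. -/
lemma mem_lsub_corner_iff (K : ClosedIdeal (Linking A B X)) {y : corner A B X} :
    y ∈ K.lsub (corner A B X) ↔ (y : Linking A B X) ∈ K := by
  have hc := corner_isImprimitivityBimodule A B X
  refine ⟨fun hy => ?_, fun hy => (mem_lsub_iff hc K).2 (K.mul_mem_right _ hy)⟩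
  exact lsub_induction hc K (p := fun y => (y : Linking A B X) ∈ K)
    (K.isClosed.preimage continuous_subtype_val) (fun y z hy hz => add_mem hy hz)
    (fun c hcK y => K.mul_mem_right _ hcK) hy

lemma mem_rsub_corner_iff (J : ClosedIdeal B) {y : corner A B X} :
    y ∈ J.rsub (corner A B X) ↔ y.1.x ∈ J.rsub X ∧ y.1.b ∈ J := by
  have hc := corner_isImprimitivityBimodule A B X
  refine ⟨fun hy => ?_, fun hy => (mem_rsub_iff hc J).2
    (add_mem (rinner_mem_of_right h J _ hy.1) (J.mul_mem_left _ hy.2))⟩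
  exact rsub_induction hc J (p := fun y => y.1.x ∈ J.rsub X ∧ y.1.b ∈ J)
    ((J.isClosed_rsub.preimage (continuous_x.comp continuous_subtype_val)).inter
      (J.isClosed.preimage (continuous_b.comp continuous_subtype_val)))
    (fun y z hy hz => ⟨add_mem hy.1 hz.1, add_mem hy.2 hz.2⟩)
    (fun b hb y => ⟨ract_mem_rsub J ⟨b, hb⟩ _, J.mul_mem_left _ hb⟩) hy

lemma lsub_corner_eq_rsub {I : ClosedIdeal A} {J : ClosedIdeal B} (hIJ : I.lsub X = J.rsub X) :
    (linking I J hIJ).lsub (corner A B X) = J.rsub (corner A B X) := by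
  ext y
  rw [mem_lsub_corner_iff, mem_rsub_corner_iff, ← hIJ]
  refine ⟨fun hy => ⟨hy.2.1, hy.2.2.2⟩, fun hy => ⟨?_, hy.1, ?_, hy.2⟩⟩
  · rw [corner_a]; exact zero_mem I
  · rw [corner_y]; exact zero_mem _

/-- A multiplier acts on the columns in `K` as it acts on `K`. -/
lemma coe_lmul_corner {K : ClosedIdeal (Linking A B X)} (m : K.Mult) {y : corner A B X}
    (hy : y ∈ K.lsub (corner A B X)) :
    ((K.lmul m y : corner A B X) : Linking A B X) =
      m.fst ⟨y, (mem_lsub_corner_iff K).1 hy⟩ := by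
  have hc := corner_isImprimitivityBimodule A B X
  have h1 : (⟨_, (mem_lsub_corner_iff K).1 (lmul_mem hc K m hy)⟩ : K) =
      m.fst ⟨y, (mem_lsub_corner_iff K).1 hy⟩ :=
    DoubleCentralizer.eq_of_mul_left fun c => by
      rw [← m.central]
      have h2 := congrArg Subtype.val (lact_lmul hc K m hy c)
      exact Subtype.ext h2
  exact congrArg Subtype.val h1

lemma corner_rmul_x {J : ClosedIdeal B} (n : J.Mult) {y : corner A B X}
    (hy : y ∈ J.rsub (corner A B X)) : (J.rmul y n).1.x = J.rmul y.1.x n := by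
  have hc := corner_isImprimitivityBimodule A B X
  exact rmul_unique h J n ((mem_rsub_corner_iff J).1 hy).1
    ((mem_rsub_corner_iff J).1 (rmul_mem hc J n hy)).1
    fun c => congrArg (fun z : corner A B X => z.1.x) (rmul_ract hc J n hy c)

lemma corner_rmul_b {J : ClosedIdeal B} (n : J.Mult) {y : corner A B X}
    (hy : y ∈ J.rsub (corner A B X)) :
    (J.rmul y n).1.b = n.snd ⟨y.1.b, ((mem_rsub_corner_iff J).1 hy).2⟩ := by
  have hc := corner_isImprimitivityBimodule A B X
  have h1 : (⟨_, ((mem_rsub_corner_iff J).1 (rmul_mem hc J n hy)).2⟩ : J) =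
      n.snd ⟨y.1.b, ((mem_rsub_corner_iff J).1 hy).2⟩ :=
    DoubleCentralizer.eq_of_mul_right fun c => by
      rw [n.central]
      exact Subtype.ext (congrArg (fun z : corner A B X => z.1.b) (rmul_ract hc J n hy c))
  exact congrArg Subtype.val h1

end Linking

namespace IsPartialAutomorphism

open ClosedIdeal Linking

variable {A B X : Type*} [NonUnitalCStarAlgebra A] [NonUnitalCStarAlgebra B]
  [NormedAddCommGroup X] [NormedSpace ℂ X] [LeftInnerData A X] [RightInnerData B X]
  [h : IsImprimitivityBimodule A B X] {I₁ I₂ : ClosedIdeal A} {J₁ J₂ : ClosedIdeal B}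
  {φA : I₁ ≃⋆ₐ[ℂ] I₂} {φ : I₁.lsub X → I₂.lsub X} {φB : J₁ ≃⋆ₐ[ℂ] J₂}
  (h₁ : I₁.lsub X = J₁.rsub X) (h₂ : I₂.lsub X = J₂.rsub X)

/-- The restriction of `linkingEquiv` to the corner. -/
noncomputable def cornerMap (P : IsPartialAutomorphism φA φ φB)
    (y : (linking I₁ J₁ h₁).lsub (corner A B X)) : (linking I₂ J₂ h₂).lsub (corner A B X) :=
  let c := P.linkingEquiv h₁ h₂ ⟨y, (mem_lsub_corner_iff _).1 y.2⟩
  have ha : c.1.a = 0 := by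
    have h0 : (⟨y.1.1.a, ((mem_lsub_corner_iff _).1 y.2).1⟩ : I₁) = 0 := Subtype.ext y.1.2.1
    exact congrArg Subtype.val ((congrArg φA h0).trans (_root_.map_zero φA))
  have hy : c.1.y = 0 := by
    have h0 : (⟨y.1.1.y, ((mem_lsub_corner_iff _).1 y.2).2.2.1⟩ : I₁.lsub X) = 0 :=
      Subtype.ext y.1.2.2
    exact congrArg Subtype.val ((congrArg φ h0).trans (P.map_zero h))
  ⟨⟨c, ha, hy⟩, (mem_lsub_corner_iff _).2 c.2⟩

/-- The restriction of `linkingEquiv` to the corner is a partial automorphism. -/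
theorem corner (P : IsPartialAutomorphism φA φ φB) :
    IsPartialAutomorphism (P.linkingEquiv h₁ h₂) (P.cornerMap h₁ h₂) φB where
  source := isImprimitivitySubbimodule (corner_isImprimitivityBimodule A B X)
    (lsub_corner_eq_rsub h₁)
  target := isImprimitivitySubbimodule (corner_isImprimitivityBimodule A B X)
    (lsub_corner_eq_rsub h₂)
  map_ract y b hyb := by
    have hy := (mem_lsub_corner_iff _).1 y.2
    have h1 := congrArg Subtype.val (_root_.map_mul φB (⟨y.1.1.b, hy.2.2.2⟩ : J₁) b)
    exact corner_ext
      (P.map_ract ⟨y.1.1.x, hy.2.1⟩ b ((mem_lsub_corner_iff _).1 hyb).2.1) h1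
  map_rinner y z hyz := by
    have hy := (mem_lsub_corner_iff _).1 y.2
    have hz := (mem_lsub_corner_iff _).1 z.2
    have hr := rinner_mem_of_left h J₁ (x := y.1.1.x) (h₁ ▸ hy.2.1) z.1.1.x
    refine (congrArg Subtype.val (_root_.map_add φB ⟨_, hr⟩
      (star ⟨y.1.1.b, hy.2.2.2⟩ * ⟨z.1.1.b, hz.2.2.2⟩))).trans ?_
    rw [_root_.map_mul, map_star]
    exact congrArg₂ (· + ·) (P.map_rinner ⟨_, hy.2.1⟩ ⟨_, hz.2.1⟩ hr) rfl
  map_lact c y hcy := by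
    have h1 := congrArg Subtype.val (_root_.map_mul (P.linkingEquiv h₁ h₂) c
      ⟨y, (mem_lsub_corner_iff _).1 y.2⟩)
    exact Subtype.ext h1
  map_linner y z hyz := by
    refine (congrArg Subtype.val (_root_.map_mul (P.linkingEquiv h₁ h₂)
      ⟨y, (mem_lsub_corner_iff _).1 y.2⟩ (star ⟨z, (mem_lsub_corner_iff _).1 z.2⟩))).trans ?_
    rw [map_star]
    rfl
  surjective z := by
    have hz := (mem_lsub_corner_iff _).1 z.2
    obtain ⟨x, hx⟩ := P.surjective ⟨z.1.1.x, hz.2.1⟩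
    obtain ⟨b, hb⟩ := φB.surjective ⟨z.1.1.b, hz.2.2.2⟩
    have hmem : (⟨0, x, 0, b⟩ : Linking A B X) ∈ linking I₁ J₁ h₁ :=
      ⟨zero_mem _, x.2, zero_mem _, b.2⟩
    exact ⟨⟨⟨⟨0, x, 0, b⟩, rfl, rfl⟩, (mem_lsub_corner_iff _).2 hmem⟩, Subtype.ext <|
      corner_ext (congrArg Subtype.val hx) (congrArg Subtype.val hb)⟩

end IsPartialAutomorphism

namespace TwistedMoritaEquivalence

open ClosedIdeal Linking

variable {S A B X : Type*} [InverseMonoid S] [NonUnitalCStarAlgebra A] [NonUnitalCStarAlgebra B]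
  [NormedAddCommGroup X] [NormedSpace ℂ X] [LeftInnerData A X] [RightInnerData B X]
  [h : IsImprimitivityBimodule A B X] {𝒜 : TwistedAction S A} {ℬ : TwistedAction S B}

/-- The corner `Y` with the restrictions of the maps `γ_s` is a Morita equivalence between the
action on the linking algebra and `ℬ`. -/
noncomputable def corner (M : TwistedMoritaEquivalence X 𝒜 ℬ) :
    TwistedMoritaEquivalence (Linking.corner A B X) M.linkingAction ℬ where
  imprimitivity := corner_isImprimitivityBimodule A B X
  sub_eq s := lsub_corner_eq_rsub (M.sub_eq s)
  φ s := (M.isPartialAutomorphism s).cornerMap (M.sub_eq s⁻¹) (M.sub_eq s)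
  isPartialAutomorphism s := (M.isPartialAutomorphism s).corner (M.sub_eq s⁻¹) (M.sub_eq s)
  dom_comp s t y := by
    rw [mem_lsub_corner_iff]
    refine (M.linkingAction.dom_comp s t y).trans ⟨?_, ?_⟩
    · rintro ⟨hy₁, hy₂⟩
      exact ⟨(mem_lsub_corner_iff _).2 hy₁, (mem_lsub_corner_iff _).2 hy₂⟩
    · rintro ⟨hy₁, hy₂⟩
      exact ⟨(mem_lsub_corner_iff _).1 hy₁, (mem_lsub_corner_iff _).1 hy₂⟩
  φ_comp s t y hy hy₁ hy₂ := by
    have hst := M.sub_eq (s * t)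
    let w := linkingMult hst (𝒜.mult s t).1 (ℬ.mult s t).1
    let w' := linkingMult hst (star (𝒜.mult s t).1) (star (ℬ.mult s t).1)
    let d := M.linkingMap (s * t) ⟨y, (mem_lsub_corner_iff _).1 hy⟩
    have hη := ((M.isPartialAutomorphism (s * t)).cornerMap (M.sub_eq _) hst ⟨y, hy⟩).2
    have h1 := M.linkingAction.map_comp s t y ((mem_lsub_corner_iff _).1 hy)
      ((mem_lsub_corner_iff _).1 hy₁) ((mem_lsub_corner_iff _).1 hy₂)
    have h2 := coe_lmul_corner w hη
    have h3 := (lsub_corner_eq_rsub hst).le (lmul_mem (corner_isImprimitivityBimodule A B X) _ w hη)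
    have h4 := (h1.trans (congrArg (fun m => ((w.fst (m.snd d) : M.linkingIdeal (s * t)) :
      Linking A B X)) (linkingMult_star hst _ _).symm)).trans
        (congrArg Subtype.val (fst_snd_comm _ w w' d))
    -- Left multiplication by `w` comes first on the right-hand side, so that `w^*` acts on a column
    -- and only its entries `x` and `b` have to be compared.
    refine corner_ext ((congrArg Linking.x h4).trans ?_) ((congrArg Linking.b h4).trans ?_)
    · refine Eq.trans ?_ (corner_rmul_x _ h3).symm
      exact congrArg (fun c : Linking A B X => (ℬ.ideal (s * t)).rmul c.x _) h2.symm
    · refine Eq.trans ?_ (corner_rmul_b _ h3).symm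
      exact congrArg (fun b => ((star (ℬ.mult s t).1).snd b : B))
        (Subtype.ext (congrArg Linking.b h2.symm))

end TwistedMoritaEquivalence

theorem mainTheorem5 {S A B X : Type*} [InverseMonoid S] [NonUnitalCStarAlgebra A]
    [NonUnitalCStarAlgebra B] [NormedAddCommGroup X] [NormedSpace ℂ X] [LeftInnerData A X]
    [RightInnerData B X] [IsImprimitivityBimodule A B X]
    (𝒜 : TwistedAction S A) (ℬ : TwistedAction S B) (M : TwistedMoritaEquivalence X 𝒜 ℬ) :
    ∃ 𝒞 : TwistedAction S (Linking A B X),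
      -- the ideals `C_s`
      (∀ (s : S) (c : Linking A B X), c ∈ 𝒞.ideal s ↔
        c.a ∈ 𝒜.ideal s ∧ c.x ∈ (𝒜.ideal s).lsub X ∧ c.y ∈ (𝒜.ideal s).lsub X ∧
          c.b ∈ ℬ.ideal s) ∧
      -- the isomorphisms `γ_s`
      (∀ (s : S) (c : 𝒞.ideal s⁻¹) (a : 𝒜.ideal s⁻¹) (x y : (𝒜.ideal s⁻¹).lsub X)
        (b : ℬ.ideal s⁻¹), (c : Linking A B X) = ⟨a, x, y, b⟩ →
        (𝒞.map s c : Linking A B X) = ⟨𝒜.map s a, M.φ s x, M.φ s y, ℬ.map s b⟩) ∧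
      -- left and right multiplication by `w_{s,t}`, the diagonal of `u_{s,t}` and `v_{s,t}`
      (∀ (s t : S) (c : 𝒞.ideal (s * t)) (a : 𝒜.ideal (s * t)) (x y : X) (b : ℬ.ideal (s * t)),
        (c : Linking A B X) = ⟨a, x, y, b⟩ →
        ((𝒞.mult s t : (𝒞.ideal (s * t)).Mult).fst c : Linking A B X) =
          ⟨(𝒜.mult s t : (𝒜.ideal (s * t)).Mult).fst a,
            (𝒜.ideal (s * t)).lmul (𝒜.mult s t : (𝒜.ideal (s * t)).Mult) x,
            (ℬ.ideal (s * t)).rmul y (star (ℬ.mult s t : (ℬ.ideal (s * t)).Mult)),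
            (ℬ.mult s t : (ℬ.ideal (s * t)).Mult).fst b⟩ ∧
        ((𝒞.mult s t : (𝒞.ideal (s * t)).Mult).snd c : Linking A B X) =
          ⟨(𝒜.mult s t : (𝒜.ideal (s * t)).Mult).snd a,
            (ℬ.ideal (s * t)).rmul x (ℬ.mult s t : (ℬ.ideal (s * t)).Mult),
            (𝒜.ideal (s * t)).lmul (star (𝒜.mult s t : (𝒜.ideal (s * t)).Mult)) y,
            (ℬ.mult s t : (ℬ.ideal (s * t)).Mult).snd b⟩) ∧
      -- the corner with the restrictions of `γ_s` is a Morita equivalence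
      ∃ N : TwistedMoritaEquivalence (Linking.corner A B X) 𝒞 ℬ,
        ∀ (s : S) (y : (𝒞.ideal s⁻¹).lsub (Linking.corner A B X)),
          ∃ hy : ((y : Linking.corner A B X) : Linking A B X) ∈ 𝒞.ideal s⁻¹,
            ((N.φ s y : Linking.corner A B X) : Linking A B X) = 𝒞.map s ⟨y, hy⟩ := by
  refine ⟨M.linkingAction, fun s c => Iff.rfl, ?_, ?_, M.corner, fun s y =>
    ⟨(Linking.mem_lsub_corner_iff _).1 y.2, rfl⟩⟩
  · rintro s ⟨_, hc⟩ a x y b rfl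
    rfl
  · rintro s t ⟨_, hc⟩ a x y b rfl
    exact ⟨rfl, rfl⟩
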